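/- **Corollary (Birkhoff polytope shadows).** For $n \ge 1$ let $B_n \subseteq \mathbb{R}^{n\times n}$ be the Birkhoff polytope, the convex hull of the $n \times n$ permutation matrices, where $\mathbb{R}^{n\times n}$ carries the Euclidean (Frobenius) inner product. For $n \ge 2$ let $(U,V)$ be a uniformly random orthonormal pair in $\mathbb{R}^{n\times n}$ (distributed according to the unique rotation-invariant probability measure on the pairs of unit vectors with $U^{\intercal}V = 0$), let $\pi(x) = (U^{\intercal}x, V^{\intercal}x)$, and let $s(B_n)$ be the number of vertices of the random shadow $\pi(B_n) \subseteq \mathbb{R}^2$. Then $s(B_n)$ is an integrable random variable for every $n \ge 2$, and 1. $\mathbb{E}[s(B_n)] \ge 4$ for every $n \ge 3$; 2. there is an absolute constant $C > 0$ such that $\mathbb{E}[s(B_n)] \le C\, n^{3/2}$ for every $n \ge 2$. -/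

import Mathlib

open MeasureTheory ProbabilityTheory
open scoped RealInnerProductSpace

noncomputable section

namespace RandomShadow

section General

variable {E : Type*} [NormedAddCommGroup E] [InnerProductSpace ℝ E]

/-- The linear map `x ↦ (uᵀ x, vᵀ x)` from `E` to the Euclidean plane. -/
def shadowMap (u v : E) : E →ₗ[ℝ] EuclideanSpace ℝ (Fin 2) where
  toFun x := !₂[⟪u, x⟫, ⟪v, x⟫]
  map_add' x y := by ext i; fin_cases i <;> simp [inner_add_right]
  map_smul' c x := by ext i; fin_cases i <;> simp [inner_smul_right]

/-- The size of the shadow of `P` along `u, v`: the number of vertices (extreme points) of the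
image of `P` under `x ↦ (uᵀ x, vᵀ x)`. -/
def shadowSize (P : Set E) (u v : E) : ℕ :=
  ((shadowMap u v '' P).extremePoints ℝ).ncard

/-- `(u, v)` is an orthonormal pair: unit vectors with `uᵀ v = 0`. -/
def IsOrthonormalPair (p : E × E) : Prop :=
  ‖p.1‖ = 1 ∧ ‖p.2‖ = 1 ∧ ⟪p.1, p.2⟫ = 0

/-- The unit vector in the direction of `x` (and `0` if `x = 0`). -/
def unitVector (x : E) : E := ‖x‖⁻¹ • x

/-- Gram-Schmidt orthonormalization of a pair of vectors. -/
def orthonormalizePair (p : E × E) : E × E :=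
  (unitVector p.1, unitVector (p.2 - ⟪unitVector p.1, p.2⟫ • unitVector p.1))

end General

variable (E : Type*) [NormedAddCommGroup E] [InnerProductSpace ℝ E] [FiniteDimensional ℝ E]
  [MeasurableSpace E]

/-- The uniform distribution on the orthonormal pairs `(U, V)` of `E`, for `dim E ≥ 2`: the law of
the Gram-Schmidt orthonormalization of two independent standard Gaussian vectors. The three facts
proved below (it is a probability measure, it is carried by the orthonormal pairs, and it is
invariant under all linear isometries of `E`) characterize the uniform distribution. -/
def uniformOrthonormalPair : Measure (E × E) :=
  ((stdGaussian E).prod (stdGaussian E)).map orthonormalizePair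

/-- The expected number of vertices of a uniformly random shadow of `P`. -/
def expectedShadowSize {E : Type*} [NormedAddCommGroup E] [InnerProductSpace ℝ E]
    [FiniteDimensional ℝ E] [MeasurableSpace E] (P : Set E) : ℝ :=
  ∫ p, (shadowSize P p.1 p.2 : ℝ) ∂(uniformOrthonormalPair E)

section Facts

variable [BorelSpace E]

variable {E} in
theorem measurable_unitVector : Measurable (unitVector : E → E) := by
  unfold unitVector; fun_prop

variable {E} in
theorem measurable_orthonormalizePair : Measurable (orthonormalizePair : E × E → E × E) := by
  have h : Measurable (unitVector : E → E) := measurable_unitVector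
  unfold orthonormalizePair
  have h1 : Measurable fun p : E × E => unitVector p.1 := h.comp measurable_fst
  exact h1.prodMk (h.comp (measurable_snd.sub ((h1.inner measurable_snd).smul h1)))

/-- The uniform distribution on orthonormal pairs is a probability measure. -/
instance isProbabilityMeasure_uniformOrthonormalPair :
    IsProbabilityMeasure (uniformOrthonormalPair E) :=
  Measure.isProbabilityMeasure_map measurable_orthonormalizePair.aemeasurable

/-- The uniform distribution on orthonormal pairs is invariant under linear isometries. -/
theorem map_uniformOrthonormalPair (f : E ≃ₗᵢ[ℝ] E) :
    (uniformOrthonormalPair E).map (Prod.map f f) = uniformOrthonormalPair E := by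
  have hf : Measurable f := f.continuous.measurable
  have hu : ∀ x : E, f (unitVector x) = unitVector (f x) := fun x => by
    simp [unitVector]
  have hc : Prod.map f f ∘ orthonormalizePair = orthonormalizePair ∘ Prod.map f f := by
    funext p
    simp [orthonormalizePair, hu, ← f.inner_map_map (unitVector p.1) p.2]
  unfold uniformOrthonormalPair
  rw [Measure.map_map (hf.prodMap hf) measurable_orthonormalizePair, hc,
    ← Measure.map_map measurable_orthonormalizePair (hf.prodMap hf),
    ← Measure.map_prod_map _ _ hf hf, stdGaussian_map f]

variable {E} in
theorem ae_inner_ne_zero {z : E} (hz : z ≠ 0) : ∀ᵐ y ∂(stdGaussian E), ⟪z, y⟫ ≠ 0 := by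
  have hm : Measurable fun y : E => ⟪z, y⟫ := by fun_prop
  have hg : (stdGaussian E).map (innerSL ℝ z) = gaussianReal 0 (‖z‖₊ ^ 2) := by
    rw [IsGaussian.map_eq_gaussianReal, integral_strongDual_stdGaussian,
      variance_dual_stdGaussian, innerSL_apply_norm]
    congr 1
    ext
    simp
  have : NullSingletonClass (gaussianReal 0 (‖z‖₊ ^ 2)) :=
    nullSingletonClass_gaussianReal (by simpa using hz)
  have h0 : ∀ᵐ t ∂((stdGaussian E).map (innerSL ℝ z)), t ≠ 0 := by
    rw [hg]; exact Measure.ae_ne _ 0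
  exact ae_of_ae_map (innerSL ℝ z).continuous.aemeasurable h0

/-- The uniform distribution on orthonormal pairs is carried by the orthonormal pairs. -/
theorem ae_isOrthonormalPair (hE : 2 ≤ Module.finrank ℝ E) :
    ∀ᵐ p ∂(uniformOrthonormalPair E), IsOrthonormalPair p := by
  have hmeas : MeasurableSet {p : E × E | IsOrthonormalPair p} := by
    refine (measurableSet_eq_fun (by fun_prop) measurable_const).inter
      ((measurableSet_eq_fun (by fun_prop) measurable_const).inter
        (measurableSet_eq_fun (by fun_prop) measurable_const))
  have hunit : ∀ x : E, x ≠ 0 → ‖unitVector x‖ = 1 := fun x hx => by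
    simp [unitVector, norm_smul, inv_mul_cancel₀ (norm_ne_zero_iff.2 hx)]
  unfold uniformOrthonormalPair
  rw [ae_map_iff measurable_orthonormalizePair.aemeasurable hmeas]
  refine (Measure.ae_prod_iff_ae_ae (measurable_orthonormalizePair hmeas)).2 ?_
  have : Nontrivial E := Module.nontrivial_of_finrank_pos (R := ℝ) (by omega)
  obtain ⟨e, he⟩ := exists_ne (0 : E)
  filter_upwards [ae_inner_ne_zero he] with x hx
  have hx0 : x ≠ 0 := by rintro rfl; simp at hx
  obtain ⟨z, hz, hzx⟩ : ∃ z : E, z ≠ 0 ∧ ⟪z, x⟫ = 0 := by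
    have h1 : Module.finrank ℝ (ℝ ∙ x) + Module.finrank ℝ (ℝ ∙ x)ᗮ = Module.finrank ℝ E :=
      Submodule.finrank_add_finrank_orthogonal _
    rw [finrank_span_singleton hx0] at h1
    have : Nontrivial (ℝ ∙ x)ᗮ := Module.nontrivial_of_finrank_pos (R := ℝ) (by omega)
    obtain ⟨z, hz⟩ := exists_ne (0 : (ℝ ∙ x)ᗮ)
    exact ⟨z, by simpa using hz, Submodule.mem_orthogonal_singleton_iff_inner_left.1 z.2⟩
  filter_upwards [ae_inner_ne_zero hz] with y hy
  have hy0 : y - ⟪unitVector x, y⟫ • unitVector x ≠ 0 := fun h => by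
    apply hy
    rw [sub_eq_zero.1 h]
    simp [unitVector, inner_smul_right, hzx]
  refine ⟨hunit x hx0, hunit _ hy0, ?_⟩
  have h1 : ⟪unitVector x, unitVector x⟫ = 1 := by
    rw [real_inner_self_eq_norm_sq, hunit x hx0]; norm_num
  change ⟪unitVector x, ‖_‖⁻¹ • (y - ⟪unitVector x, y⟫ • unitVector x)⟫ = 0
  rw [inner_smul_right, inner_sub_right, inner_smul_right, h1]
  simp

end Facts

/-- The Birkhoff polytope `B_n`: the convex hull of the `n × n` permutation matrices, in the
Euclidean space `ℝ^(n × n)` of real `n × n` matrices. -/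
def birkhoffPolytope (n : ℕ) : Set (EuclideanSpace ℝ (Fin n × Fin n)) :=
  convexHull ℝ (Set.range fun σ : Equiv.Perm (Fin n) =>
    WithLp.toLp 2 fun ij : Fin n × Fin n => σ.permMatrix ℝ ij.1 ij.2)

end RandomShadow

end

/-! The proof counts edges of the shadow and weighs them by their length in `ℝ^(n × n)`.
Gram-Schmidt multiplies all orientation determinants of the projected points by one positive factor,
so the random orthonormal pair may be replaced by two independent standard Gaussian vectors. Almost
surely the projected permutation matrices have distinct abscissae and no three are collinear,
because the matrices lie on a sphere. The shadow then has as many vertices as oriented edges, and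
the expected size is the sum of `edgeProb` over ordered pairs (`expectedShadowSize_eq_sum`).
Integrability is clear, since almost surely the size is a finite sum of indicators.

Let `d = v a - v b`. Whether `(a, b)` projects to an edge depends only on the direction of the
vector of the random plane orthogonal to `d`, and this direction is independent of `⟪p.1, d⟫`
(`lintegral_mul_indicator_orthDir`). Hence the expected horizontal extent of a lower edge is `‖d‖ /
√(2π)` times its probability. The lower edges tile the horizontal projection of the shadow
(`sum_lowerEdge`), whose length is the width of the family. This yields the identity
`sum_norm_mul_edgeProb`: the sum of `‖v a - v b‖ * edgeProb v a b` is `2 √(2π)` times the mean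
support function `M n`, here `meanSupport n`.

Distances between distinct permutation matrices lie between `2` and `√(2n)`. The lower limit with `M
n ≤ n √n` (Cauchy-Schwarz) gives the bound `√(2π) n^(3/2)`. The upper limit with `M n ≥ n / √π` for
`n ≥ 3` (`le_meanSupport`) gives at least `2 √n`, which suffices for `n ≥ 4`. For `n = 3` the
lengths are only `2` and `√6`, and each of the 12 ordered pairs at distance `√6` is an edge with
probability at most `1 / 5` (`edgeProb_three_le`). This correction brings the bound above `4`. -/

noncomputable section

namespace RandomShadow

/-! ### Edges and vertices of the convex hull of planar points in general position. -/

section Planar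

variable {ι : Type*}

/-- The orientation determinant of the planar points `a`, `b`, `c`. -/
def cross (x y : ι → ℝ) (a b c : ι) : ℝ :=
  (x a - x b) * (y a - y c) - (y a - y b) * (x a - x c)

/-- `(a, b)` is an edge of the convex hull, with all other points to its left. -/
def IsEdge (x y : ι → ℝ) (a b : ι) : Prop :=
  a ≠ b ∧ ∀ c, c ≠ a → c ≠ b → 0 < cross x y a b c

/-- No two points have the same abscissa and no three points are collinear. -/
def Generic (x y : ι → ℝ) : Prop :=
  (∀ a b, a ≠ b → x a ≠ x b) ∧
    ∀ a b c, a ≠ b → a ≠ c → b ≠ c → cross x y a b c ≠ 0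

/-- The planar points with given coordinates. -/
def point (x y : ι → ℝ) (a : ι) : EuclideanSpace ℝ (Fin 2) := !₂[x a, y a]

variable {x y : ι → ℝ}

lemma cross_swap (a b c : ι) : cross x y a c b = -cross x y a b c := by
  unfold cross; ring

lemma Generic.injective_point (h : Generic x y) : Function.Injective (point x y) := by
  intro a b hab
  by_contra hne
  exact h.1 a b hne (by simpa [point] using congrArg (fun z => z 0) hab)

lemma IsEdge.right_unique {a b c : ι} (h : IsEdge x y a b) (h' : IsEdge x y a c) : b = c := by
  by_contra hne
  have h1 := h.2 c h'.1.symm (Ne.symm hne)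
  have h2 := h'.2 b h.1.symm hne
  rw [cross_swap] at h2
  linarith

/-- An open half-space together with one point of its boundary is convex, so it contains the whole
hull as soon as it contains the points `p c`. -/
lemma mem_extremePoints_of_strict {F : Type*} [AddCommGroup F] [Module ℝ F] {p : ι → F}
    (g : F →ₗ[ℝ] ℝ) {a : ι} (hg : ∀ c, c ≠ a → g (p a) < g (p c)) :
    p a ∈ (convexHull ℝ (Set.range p)).extremePoints ℝ := by
  set T : Set F := {z | z = p a ∨ g (p a) < g z} with hT
  have hge : ∀ z ∈ T, g (p a) ≤ g z := by
    rintro z (rfl | hz)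
    · exact le_rfl
    · exact hz.le
  have hTc : Convex ℝ T := by
    intro z hz w hw s t hs ht hst
    rcases hs.eq_or_lt with rfl | hs
    · obtain rfl : t = 1 := by linarith
      simpa using hw
    rcases ht.eq_or_lt with rfl | ht
    · obtain rfl : s = 1 := by linarith
      simpa using hz
    have hz' := hge z hz
    have hw' := hge w hw
    have key : g (s • z + t • w) = s * g z + t * g w := by simp
    have hga : s * g (p a) + t * g (p a) = g (p a) := by rw [← add_mul, hst, one_mul]
    rcases hz with rfl | hz
    · rcases hw with rfl | hw
      · left; rw [← add_smul, hst, one_smul]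
      · right; rw [key]; nlinarith
    · right; rw [key]; nlinarith
  have hsub : convexHull ℝ (Set.range p) ⊆ T := by
    refine convexHull_min ?_ hTc
    rintro _ ⟨c, rfl⟩
    by_cases hc : c = a
    · left; rw [hc]
    · right; exact hg c hc
  refine mem_extremePoints_iff_left.2 ⟨subset_convexHull _ _ ⟨a, rfl⟩, ?_⟩
  rintro z hz w hw ⟨s, t, hs, ht, hst, h⟩
  rcases hsub hz with h1 | h1
  · exact h1
  · have h2 := hge w (hsub hw)
    have h3 : s * g z + t * g w = g (p a) := by rw [← h]; simp
    have hga : s * g (p a) + t * g (p a) = g (p a) := by rw [← add_mul, hst, one_mul]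
    nlinarith

/-- The functional that defines the edge is minimal at both `a` and `b`. A small tilt by `ε` makes
`a` the only minimizer; at `b` the gain is `ε (x b - x a)²`, positive because the abscissae differ.
-/
lemma IsEdge.mem_extremePoints [Finite ι] (hgen : Generic x y) {a b : ι} (h : IsEdge x y a b) :
    point x y a ∈ (convexHull ℝ (Set.range (point x y))).extremePoints ℝ := by
  obtain ⟨ε, hε0, hε⟩ : ∃ ε > 0, ∀ c, c ≠ a → c ≠ b →
      0 < cross x y a b c + ε * ((x b - x a) * (x c - x a)) := by
    have h1 : ∀ᶠ ε in nhdsWithin (0 : ℝ) (Set.Ioi 0), ∀ c, c ≠ a → c ≠ b →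
        0 < cross x y a b c + ε * ((x b - x a) * (x c - x a)) := by
      refine Filter.eventually_all.2 fun c => ?_
      by_cases hc : c ≠ a ∧ c ≠ b
      · have ht : Filter.Tendsto (fun ε : ℝ => cross x y a b c +
            ε * ((x b - x a) * (x c - x a))) (nhdsWithin 0 (Set.Ioi 0))
            (nhds (cross x y a b c)) := by
          have : Continuous (fun ε : ℝ => cross x y a b c +
            ε * ((x b - x a) * (x c - x a))) := by fun_prop
          have := this.tendsto 0
          simp only [zero_mul, add_zero] at this
          exact this.mono_left nhdsWithin_le_nhds
        filter_upwards [ht.eventually (lt_mem_nhds (h.2 c hc.1 hc.2))] with ε hε _ _ using hε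
      · filter_upwards with ε h1 h2
        exact absurd ⟨h1, h2⟩ hc
    obtain ⟨ε, h2, h3⟩ := (h1.and self_mem_nhdsWithin).exists
    exact ⟨ε, h3, h2⟩
  let g : EuclideanSpace ℝ (Fin 2) →ₗ[ℝ] ℝ :=
    { toFun := fun z => (x b - x a) * z 1 - (y b - y a) * z 0 + ε * (x b - x a) * z 0
      map_add' := fun z w => by simp; ring
      map_smul' := fun c z => by simp; ring }
  refine mem_extremePoints_of_strict g fun c hc => ?_
  change (x b - x a) * y a - (y b - y a) * x a + ε * (x b - x a) * x a <
    (x b - x a) * y c - (y b - y a) * x c + ε * (x b - x a) * x c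
  by_cases hcb : c = b
  · subst hcb
    have : 0 < ε * (x c - x a) ^ 2 := by
      have := sub_ne_zero.2 (hgen.1 c a hc)
      positivity
    nlinarith
  · have := hε c hc hcb
    unfold cross at this
    nlinarith

/-- A functional separating the extreme point from the others puts them all in an open half-plane
seen from `a`. The first of them in angular order is the next vertex. -/
lemma exists_isEdge [Fintype ι] [Nontrivial ι] [DecidableEq ι] (hgen : Generic x y) {a : ι}
    (h : point x y a ∈ (convexHull ℝ (Set.range (point x y))).extremePoints ℝ) :
    ∃ b, IsEdge x y a b := by
  set T : Set (EuclideanSpace ℝ (Fin 2)) := convexHull ℝ (point x y '' {a}ᶜ) with hT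
  have hnot : point x y a ∉ T := by
    have h1 := ((convex_convexHull ℝ _).mem_extremePoints_iff_convex_sdiff.1 h).2
    have h2 : T ⊆ convexHull ℝ (Set.range (point x y)) \ {point x y a} := by
      refine convexHull_min ?_ h1
      rintro _ ⟨c, hc, rfl⟩
      exact ⟨subset_convexHull _ _ ⟨c, rfl⟩, fun h => hc (hgen.injective_point h)⟩
    exact fun h => (h2 h).2 rfl
  have hcl : IsClosed T := (Set.toFinite _).isClosed_convexHull ℝ
  obtain ⟨f, u, hfa, hfT⟩ := geometric_hahn_banach_point_closed (convex_convexHull ℝ _) hcl hnot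
  have hlt : ∀ c, c ≠ a → 0 < f (point x y c) - f (point x y a) := fun c hc => by
    have := hfT _ (subset_convexHull ℝ _ ⟨c, hc, rfl⟩)
    linarith
  set α := f !₂[1, 0]
  set β := f !₂[0, 1]
  have hf : ∀ c, f (point x y c) = α * x c + β * y c := fun c => by
    have : point x y c = x c • !₂[(1 : ℝ), 0] + y c • !₂[(0 : ℝ), 1] := by
      ext i; fin_cases i <;> simp [point]
    rw [this, map_add, map_smul, map_smul, smul_eq_mul, smul_eq_mul]; ring
  -- `L` and `M` are orthogonal coordinates centred at `a`, with `L` positive at the other points,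
  -- so that minimal slope `M / L` means minimal angle.
  set L : ι → ℝ := fun c => α * (x c - x a) + β * (y c - y a)
  set M : ι → ℝ := fun c => α * (y c - y a) - β * (x c - x a)
  have hL : ∀ c, c ≠ a → 0 < L c := fun c hc => by
    have := hlt c hc
    rw [hf, hf] at this
    simp only [L]; linarith
  obtain ⟨b', hb'⟩ := exists_ne a
  obtain ⟨b, hb, hmin⟩ := Finset.exists_min_image (Finset.univ.erase a) (fun c => M c / L c)
    ⟨b', by simp [hb']⟩
  have hba : b ≠ a := by simpa using hb
  refine ⟨b, hba.symm, fun c hca hcb => ?_⟩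
  have h1 := hmin c (by simp [hca])
  rw [div_le_div_iff₀ (hL b hba) (hL c hca)] at h1
  have h2 : L b * M c - M b * L c = (α ^ 2 + β ^ 2) * cross x y a b c := by
    simp only [L, M, cross]; ring
  have h3 : 0 < α ^ 2 + β ^ 2 := by
    by_contra hcon
    have hα : α = 0 := by nlinarith [sq_nonneg α, sq_nonneg β]
    have hβ : β = 0 := by nlinarith [sq_nonneg α, sq_nonneg β]
    have := hL b hba
    simp [L, hα, hβ] at this
  have h4 : 0 ≤ cross x y a b c := by
    by_contra hcon
    nlinarith
  exact lt_of_le_of_ne h4 (hgen.2 a b c hba.symm hca.symm hcb.symm).symm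

open Classical in
/-- The number of vertices of the convex hull is the number of its edges. -/
theorem ncard_extremePoints [Fintype ι] [Nontrivial ι] (hgen : Generic x y) :
    ((convexHull ℝ (Set.range (point x y))).extremePoints ℝ).ncard =
      (Finset.univ.filter fun e : ι × ι => IsEdge x y e.1 e.2).card := by
  have h : (convexHull ℝ (Set.range (point x y))).extremePoints ℝ =
      (fun e : ι × ι => point x y e.1) ''
        (Finset.univ.filter fun e : ι × ι => IsEdge x y e.1 e.2 : Finset (ι × ι)) := by
    ext z
    constructor
    · intro hz
      obtain ⟨a, rfl⟩ := extremePoints_convexHull_subset hz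
      obtain ⟨b, hb⟩ := exists_isEdge hgen hz
      exact ⟨(a, b), by simpa using hb, rfl⟩
    · rintro ⟨e, he, rfl⟩
      exact IsEdge.mem_extremePoints hgen (by simpa using he)
  rw [h, Set.InjOn.ncard_image, Set.ncard_coe_finset]
  rintro ⟨a, b⟩ hab ⟨a', b'⟩ hab' heq
  obtain rfl : a = a' := hgen.injective_point heq
  have h1 : IsEdge x y a b := by simpa using hab
  have h2 : IsEdge x y a b' := by simpa using hab'
  rw [h1.right_unique h2]

/-- The height over `t` of the line through the points `a` and `b`. -/
def chord (x y : ι → ℝ) (a b : ι) (t : ℝ) : ℝ :=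
  y a + (y b - y a) / (x b - x a) * (t - x a)

lemma cross_eq_chord {a b c : ι} (hab : x a < x b) :
    cross x y a b c = (x b - x a) * (y c - chord x y a b (x c)) := by
  have : x b - x a ≠ 0 := by linarith
  unfold cross chord
  field_simp
  ring

lemma chord_left (x y : ι → ℝ) (a b : ι) : chord x y a b (x a) = y a := by
  simp [chord]

lemma chord_right {a b : ι} (hab : x a < x b) : chord x y a b (x b) = y b := by
  have : x b - x a ≠ 0 := by linarith
  unfold chord
  field_simp
  ring

lemma chord_affine (x y : ι → ℝ) (a b : ι) {r s t u v : ℝ} (hrs : r + s = 1)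
    (h : r * u + s * v = t) :
    chord x y a b t = r * chord x y a b u + s * chord x y a b v := by
  obtain rfl : r = 1 - s := by linarith
  subst h
  unfold chord
  ring

/-- The height over `t` between `x a` and `x b` is the corresponding convex combination. -/
lemma exists_weights {a b : ι} {t : ℝ} (ha : x a < t) (hb : t < x b) :
    ∃ r s : ℝ, 0 < r ∧ 0 < s ∧ r + s = 1 ∧ r * x a + s * x b = t := by
  have h : 0 < x b - x a := by linarith
  refine ⟨(x b - t) / (x b - x a), (t - x a) / (x b - x a), div_pos (by linarith) h,
    div_pos (by linarith) h, ?_, ?_⟩ <;> field_simp <;> ring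

/-- Among the pairs straddling `t`, take one whose chord is lowest over `t`. A point below this
chord could replace the endpoint on its own side of `t` and give a lower chord. -/
lemma exists_lowerEdge [Finite ι] (hgen : Generic x y) {a₀ b₀ : ι} {t : ℝ}
    (ht : ∀ c, x c ≠ t) (ha₀ : x a₀ < t) (hb₀ : t < x b₀) :
    ∃ a b, IsEdge x y a b ∧ x a < t ∧ t < x b := by
  obtain ⟨⟨a, b⟩, ⟨ha, hb⟩, hmin⟩ := Set.exists_min_image
    {e : ι × ι | x e.1 < t ∧ t < x e.2} (fun e => chord x y e.1 e.2 t)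
    (Set.toFinite _) ⟨(a₀, b₀), ha₀, hb₀⟩
  simp only at ha hb hmin
  have hab : x a < x b := ha.trans hb
  refine ⟨a, b, ⟨fun h => by simp [h] at hab, fun c hca hcb => ?_⟩, ha, hb⟩
  by_contra hcon
  have hneg : cross x y a b c < 0 := lt_of_le_of_ne (not_lt.1 hcon)
    (hgen.2 a b c (fun h => by simp [h] at hab) hca.symm hcb.symm)
  rw [cross_eq_chord hab] at hneg
  have hc : y c < chord x y a b (x c) := by nlinarith
  rcases lt_or_gt_of_ne (ht c) with hct | hct
  · obtain ⟨r, s, hr, hs, hrs, hx⟩ := exists_weights hct hb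
    have h1 := hmin (c, b) ⟨hct, hb⟩
    simp only at h1
    rw [chord_affine x y a b hrs hx, chord_affine x y c b hrs hx, chord_right hab,
      chord_right (hct.trans hb), chord_left] at h1
    nlinarith
  · obtain ⟨r, s, hr, hs, hrs, hx⟩ := exists_weights ha hct
    have h1 := hmin (a, c) ⟨ha, hct⟩
    simp only at h1
    rw [chord_affine x y a b hrs hx, chord_affine x y a c hrs hx, chord_left,
      chord_right (ha.trans hct), chord_left] at h1
    nlinarith

lemma IsEdge.chord_le {a b : ι} (h : IsEdge x y a b) (hab : x a < x b) (c : ι) :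
    chord x y a b (x c) ≤ y c ∧ (c ≠ a → c ≠ b → chord x y a b (x c) < y c) := by
  have hlt : c ≠ a → c ≠ b → chord x y a b (x c) < y c := fun hca hcb => by
    have := h.2 c hca hcb
    rw [cross_eq_chord hab] at this
    by_contra hcon
    nlinarith
  refine ⟨?_, hlt⟩
  by_cases hca : c = a
  · rw [hca, chord_left]
  by_cases hcb : c = b
  · rw [hcb, chord_right hab]
  exact (hlt hca hcb).le

/-- All points are on or above the line through a lower edge, hence so is every chord over `t`.
Strictness makes the lower edge over `t` unique. -/
lemma lowerEdge_le {a b a' b' : ι} {t : ℝ} (h : IsEdge x y a b) (ha : x a < t) (hb : t < x b)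
    (ha' : x a' < t) (hb' : t < x b') :
    chord x y a b t ≤ chord x y a' b' t ∧
      ((a', b') ≠ (a, b) → chord x y a b t < chord x y a' b' t) := by
  obtain ⟨r, s, hr, hs, hrs, hx⟩ := exists_weights ha' hb'
  have hab := ha.trans hb
  rw [chord_affine x y a b hrs hx, chord_affine x y a' b' hrs hx, chord_left,
    chord_right (ha'.trans hb')]
  obtain ⟨h1, h1'⟩ := h.chord_le hab a'
  obtain ⟨h2, h2'⟩ := h.chord_le hab b'
  refine ⟨by nlinarith, fun hne => ?_⟩
  by_cases haa : a' = a
  · have hbb : b' ≠ b := fun hbb => hne (by rw [haa, hbb])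
    have := h2' (fun h => by rw [h] at hb'; linarith) hbb
    nlinarith
  · have := h1' haa (fun h => by rw [h] at ha'; linarith)
    nlinarith

lemma lowerEdge_unique {a b a' b' : ι} {t : ℝ} (h : IsEdge x y a b) (ha : x a < t)
    (hb : t < x b) (h' : IsEdge x y a' b') (ha' : x a' < t) (hb' : t < x b') :
    (a', b') = (a, b) := by
  by_contra hne
  exact absurd ((lowerEdge_le h ha hb ha' hb').2 hne) (lowerEdge_le h' ha' hb' ha hb).1.not_gt

open Classical in
/-- The projections of the lower edges of the convex hull tile its projection. -/
theorem sum_lowerEdge [Fintype ι] (hgen : Generic x y) {a₀ b₀ : ι}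
    (hmin : ∀ c, x a₀ ≤ x c) (hmax : ∀ c, x c ≤ x b₀) :
    ∑ e : ι × ι, (if IsEdge x y e.1 e.2 then ENNReal.ofReal (x e.2 - x e.1) else 0) =
      ENNReal.ofReal (x b₀ - x a₀) := by
  -- Lengths become integrals of indicators, and almost every `t` in the projection lies under
  -- exactly one lower edge. Upper edges run from right to left: `ENNReal.ofReal` sends them to `0`,
  -- and their interval is empty.
  have h1 : ∀ e : ι × ι, (if IsEdge x y e.1 e.2 then ENNReal.ofReal (x e.2 - x e.1) else 0) =
      ∫⁻ t : ℝ, (Set.Ioo (x e.1) (x e.2)).indicator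
        (fun _ => if IsEdge x y e.1 e.2 then 1 else 0) t := fun e => by
    rw [lintegral_indicator measurableSet_Ioo]
    split_ifs <;> simp
  simp_rw [h1]
  rw [← lintegral_finsetSum _ fun e _ => measurable_const.indicator measurableSet_Ioo]
  have h2 : ENNReal.ofReal (x b₀ - x a₀) =
      ∫⁻ t : ℝ, (Set.Ioo (x a₀) (x b₀)).indicator (fun _ => 1) t := by
    rw [lintegral_indicator measurableSet_Ioo]; simp
  rw [h2]
  refine lintegral_congr_ae ?_
  have hae : ∀ᵐ t : ℝ, ∀ c, x c ≠ t := by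
    rw [ae_all_iff]
    intro c
    filter_upwards [Measure.ae_ne volume (x c)] with t ht using ht.symm
  filter_upwards [hae] with t ht
  by_cases htI : t ∈ Set.Ioo (x a₀) (x b₀)
  · obtain ⟨a, b, hab, ha, hb⟩ := exists_lowerEdge hgen ht htI.1 htI.2
    rw [Set.indicator_of_mem htI, Finset.sum_eq_single (a, b)]
    · rw [Set.indicator_of_mem (show t ∈ Set.Ioo (x a) (x b) from ⟨ha, hb⟩), if_pos hab]
    · rintro ⟨a', b'⟩ - hne
      by_cases hI : t ∈ Set.Ioo (x a') (x b')
      · rw [Set.indicator_of_mem hI, if_neg]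
        exact fun h => hne (lowerEdge_unique hab ha hb h hI.1 hI.2)
      · exact Set.indicator_of_notMem hI _
    · simp
  · rw [Set.indicator_of_notMem htI]
    refine Finset.sum_eq_zero fun e _ => Set.indicator_of_notMem (fun hI => htI ?_) _
    exact ⟨(hmin _).trans_lt hI.1, hI.2.trans_le (hmax _)⟩

end Planar

/-! ### Decomposition of vectors along and orthogonally to a direction. -/

section Components

variable {E : Type*} [NormedAddCommGroup E] [InnerProductSpace ℝ E]

/-- The component of `x` along `d`. -/
def alongComp (d x : E) : E := (⟪x, d⟫ / ‖d‖ ^ 2) • d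

/-- The component of `x` orthogonal to `d`. -/
def orthComp (d x : E) : E := x - alongComp d x

lemma alongComp_inner (d x t : E) : ⟪alongComp d x, t⟫ = ⟪x, alongComp d t⟫ := by
  simp only [alongComp, real_inner_smul_left, real_inner_smul_right, real_inner_comm t d]
  ring

lemma orthComp_inner (d x t : E) : ⟪orthComp d x, t⟫ = ⟪x, orthComp d t⟫ := by
  simp only [orthComp, inner_sub_left, inner_sub_right, alongComp_inner]

lemma alongComp_inner_self {d : E} (hd : d ≠ 0) (x : E) : ⟪alongComp d x, d⟫ = ⟪x, d⟫ := by
  have : ‖d‖ ≠ 0 := by simpa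
  rw [alongComp, real_inner_smul_left, real_inner_self_eq_norm_sq]
  field_simp

lemma orthComp_inner_self {d : E} (hd : d ≠ 0) (x : E) : ⟪orthComp d x, d⟫ = 0 := by
  rw [orthComp, inner_sub_left, alongComp_inner_self hd, sub_self]

lemma norm_comp_sq {d : E} (hd : d ≠ 0) (x : E) :
    ‖orthComp d x‖ ^ 2 + ‖alongComp d x‖ ^ 2 = ‖x‖ ^ 2 := by
  have h : ⟪orthComp d x, alongComp d x⟫ = 0 := by
    rw [alongComp, real_inner_smul_right, orthComp_inner_self hd, mul_zero]
  have h2 : x = orthComp d x + alongComp d x := by simp [orthComp]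
  conv_rhs => rw [h2]
  rw [norm_add_sq_real, h]
  ring

/-- The vector of the plane of `p` that is orthogonal to `d`. -/
def orthDir (d : E) (p : E × E) : E := ⟪p.2, d⟫ • p.1 - ⟪p.1, d⟫ • p.2

lemma orthDir_comp {d : E} (hd : d ≠ 0) (x x' y y' : E) :
    orthDir d (orthComp d x + alongComp d x', orthComp d y + alongComp d y') =
      orthComp d (⟪y', d⟫ • x - ⟪x', d⟫ • y) := by
  simp only [orthDir, inner_add_left, orthComp_inner_self hd, alongComp_inner_self hd, zero_add]
  simp only [orthComp, alongComp, inner_sub_left, real_inner_smul_left]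
  module

end Components

/-! ### Images of Gaussian vectors and the independence of `orthDir` from the component along `d`.
-/

section Gaussian

variable {E F : Type*} [NormedAddCommGroup E] [InnerProductSpace ℝ E] [FiniteDimensional ℝ E]
  [MeasurableSpace E] [BorelSpace E] [NormedAddCommGroup F] [InnerProductSpace ℝ F]
  [FiniteDimensional ℝ F] [MeasurableSpace F] [BorelSpace F]

/-- A coisometry (with adjoint `f'`) maps the standard Gaussian law to the standard Gaussian law. -/
lemma map_stdGaussian_of_adjoint {f : E → F} (hf : Measurable f) {f' : F → E}
    (hadj : ∀ x t, ⟪f x, t⟫ = ⟪x, f' t⟫) (hnorm : ∀ t, ‖f' t‖ = ‖t‖) :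
    (stdGaussian E).map f = stdGaussian F := by
  have := Measure.isProbabilityMeasure_map (μ := stdGaussian E) hf.aemeasurable
  apply Measure.ext_of_charFun
  ext t
  rw [charFun_stdGaussian, charFun_apply, integral_map hf.aemeasurable (by fun_prop)]
  simp_rw [hadj]
  rw [← charFun_apply, charFun_stdGaussian, hnorm]

/-- A sum of images of two independent standard Gaussian vectors is a standard Gaussian vector if
the covariances add up to the identity. -/
lemma map_prod_stdGaussian {f g : E → F} (hf : Measurable f) (hg : Measurable g) {f' g' : F → E}
    (hfadj : ∀ x t, ⟪f x, t⟫ = ⟪x, f' t⟫) (hgadj : ∀ x t, ⟪g x, t⟫ = ⟪x, g' t⟫)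
    (hnorm : ∀ t, ‖f' t‖ ^ 2 + ‖g' t‖ ^ 2 = ‖t‖ ^ 2) :
    ((stdGaussian E).prod (stdGaussian E)).map (fun z => f z.1 + g z.2) = stdGaussian F := by
  have hm : Measurable fun z : E × E => f z.1 + g z.2 := by fun_prop
  have := Measure.isProbabilityMeasure_map (μ := (stdGaussian E).prod (stdGaussian E))
    hm.aemeasurable
  apply Measure.ext_of_charFun
  ext t
  rw [charFun_stdGaussian, charFun_apply, integral_map hm.aemeasurable (by fun_prop)]
  simp_rw [inner_add_left, hfadj, hgadj, Complex.ofReal_add, add_mul, Complex.exp_add]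
  rw [integral_prod_mul (fun x : E => Complex.exp (⟪x, f' t⟫ * Complex.I))
    (fun x : E => Complex.exp (⟪x, g' t⟫ * Complex.I)), ← charFun_apply, ← charFun_apply,
    charFun_stdGaussian, charFun_stdGaussian, ← Complex.exp_add, ← Complex.ofReal_pow,
    ← Complex.ofReal_pow, ← Complex.ofReal_pow, ← hnorm t]
  push_cast
  ring_nf

@[fun_prop]
lemma measurable_alongComp (d : E) : Measurable (alongComp d) := by
  unfold alongComp; fun_prop

@[fun_prop]
lemma measurable_orthComp (d : E) : Measurable (orthComp d) := by
  unfold orthComp; fun_prop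

lemma map_comb_stdGaussian {s t : ℝ} (hs : s ≠ 0) :
    ((stdGaussian E).prod (stdGaussian E)).map
      (fun z => (t / √(s ^ 2 + t ^ 2)) • z.1 + (-s / √(s ^ 2 + t ^ 2)) • z.2) =
      stdGaussian E := by
  have h : 0 < s ^ 2 + t ^ 2 := by positivity
  refine map_prod_stdGaussian (f' := fun x => (t / √(s ^ 2 + t ^ 2)) • x)
    (g' := fun x => (-s / √(s ^ 2 + t ^ 2)) • x) (by fun_prop) (by fun_prop)
    (fun x u => by simp [real_inner_smul_left, real_inner_smul_right])
    (fun x u => by simp [real_inner_smul_left, real_inner_smul_right]) fun x => ?_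
  rw [norm_smul, norm_smul, mul_pow, mul_pow, Real.norm_eq_abs, Real.norm_eq_abs, sq_abs, sq_abs,
    div_pow, div_pow, Real.sq_sqrt h.le]
  field_simp
  ring

@[fun_prop]
lemma measurable_orthDir (d : E) : Measurable (orthDir d) := by
  unfold orthDir; fun_prop

/-- After division by `√(s ^ 2 + t ^ 2)` the combination `t • x - s • y` is standard Gaussian, and a
cone does not see this factor. The result depends on neither `s` nor `t`. -/
lemma measure_comb {d : E} {K : Set E} (hK : MeasurableSet K)
    (hcone : ∀ r : ℝ, 0 < r → ∀ w, r • w ∈ K ↔ w ∈ K) {s t : ℝ} (hs : s ≠ 0) :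
    ∫⁻ x, ∫⁻ y, K.indicator 1 (orthComp d (t • x - s • y)) ∂(stdGaussian E) ∂(stdGaussian E) =
      stdGaussian E {x | orthComp d x ∈ K} := by
  have h : 0 < √(s ^ 2 + t ^ 2) := Real.sqrt_pos.2 (by positivity)
  have hm : MeasurableSet {x | orthComp d x ∈ K} := measurable_orthComp d hK
  rw [← map_comb_stdGaussian (E := E) (t := t) hs, ← lintegral_indicator_one hm,
    lintegral_map (measurable_one.indicator hm) (by fun_prop), map_comb_stdGaussian hs,
    lintegral_prod _ (by
      refine Measurable.aemeasurable ?_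
      exact (measurable_one.indicator hm).comp (by fun_prop))]
  refine lintegral_congr fun x => lintegral_congr fun y => ?_
  have h1 : (orthComp d (t • x - s • y) ∈ K) ↔
      ((t / √(s ^ 2 + t ^ 2)) • x + (-s / √(s ^ 2 + t ^ 2)) • y) ∈ {x | orthComp d x ∈ K} := by
    rw [Set.mem_ofPred_eq, ← hcone _ h (orthComp d (_ • x + _ • y))]
    have : √(s ^ 2 + t ^ 2) • orthComp d ((t / √(s ^ 2 + t ^ 2)) • x +
        (-s / √(s ^ 2 + t ^ 2)) • y) = orthComp d (√(s ^ 2 + t ^ 2) •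
        ((t / √(s ^ 2 + t ^ 2)) • x + (-s / √(s ^ 2 + t ^ 2)) • y)) := by
      simp only [orthComp, alongComp, real_inner_smul_left]
      module
    rw [this, smul_add, smul_smul, smul_smul, mul_div_cancel₀ _ h.ne', mul_div_cancel₀ _ h.ne',
      neg_smul, sub_eq_add_neg]
  by_cases h2 : orthComp d (t • x - s • y) ∈ K
  · rw [Set.indicator_of_mem h2, Set.indicator_of_mem (h1.1 h2)]; rfl
  · rw [Set.indicator_of_notMem h2, Set.indicator_of_notMem (fun h => h2 (h1.2 h))]

/-- The direction of the normal vector `orthDir d` is independent of the component along `d`. -/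
theorem lintegral_mul_indicator_orthDir {d : E} (hd : d ≠ 0) {K : Set E} (hK : MeasurableSet K)
    (hcone : ∀ r : ℝ, 0 < r → ∀ w, r • w ∈ K ↔ w ∈ K) {g : ℝ → ENNReal} (hg : Measurable g) :
    ∫⁻ p, g ⟪p.1, d⟫ * K.indicator 1 (orthDir d p) ∂((stdGaussian E).prod (stdGaussian E)) =
      (∫⁻ x, g ⟪x, d⟫ ∂(stdGaussian E)) * stdGaussian E {x | orthComp d x ∈ K} := by
  set μ := stdGaussian E with hμ
  -- `φ` assembles a standard Gaussian vector from independent components along and orthogonal to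
  -- `d`. Writing both vectors of the pair in this way gives four independent Gaussians.
  set φ : E × E → E := fun z => alongComp d z.1 + orthComp d z.2 with hφ
  have hφm : Measurable φ := by fun_prop
  have hmap : (μ.prod μ).map φ = μ :=
    map_prod_stdGaussian (by fun_prop) (by fun_prop) (alongComp_inner d) (orthComp_inner d)
      (fun x => by rw [add_comm]; exact norm_comp_sq hd x)
  have hKi : Measurable (K.indicator (1 : E → ENNReal)) := measurable_one.indicator hK
  have hpt : ∀ x' x y' y : E, g ⟪φ (x', x), d⟫ * K.indicator 1 (orthDir d (φ (x', x), φ (y', y))) =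
      g ⟪x', d⟫ * K.indicator 1 (orthComp d (⟪y', d⟫ • x - ⟪x', d⟫ • y)) := fun x' x y' y => by
    simp only [hφ]
    rw [inner_add_left, alongComp_inner_self hd, orthComp_inner_self hd, add_zero,
      add_comm (alongComp d x'), add_comm (alongComp d y'), orthDir_comp hd]
  have hF : Measurable fun p : E × E => g ⟪p.1, d⟫ * K.indicator 1 (orthDir d p) := by fun_prop
  calc ∫⁻ p, g ⟪p.1, d⟫ * K.indicator 1 (orthDir d p) ∂(μ.prod μ)
      = ∫⁻ u, ∫⁻ v, g ⟪u, d⟫ * K.indicator 1 (orthDir d (u, v)) ∂μ ∂μ :=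
        lintegral_prod _ hF.aemeasurable
    _ = ∫⁻ z, ∫⁻ w, g ⟪φ z, d⟫ * K.indicator 1 (orthDir d (φ z, φ w)) ∂(μ.prod μ) ∂(μ.prod μ) := by
        conv_lhs => rw [← hmap]
        rw [lintegral_map (by fun_prop) hφm]
        refine lintegral_congr fun z => ?_
        rw [lintegral_map (by fun_prop) hφm]
    _ = ∫⁻ x', ∫⁻ x, ∫⁻ y', ∫⁻ y, g ⟪x', d⟫ *
          K.indicator 1 (orthComp d (⟪y', d⟫ • x - ⟪x', d⟫ • y)) ∂μ ∂μ ∂μ ∂μ := by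
        rw [lintegral_prod _ (by fun_prop)]
        refine lintegral_congr fun x' => lintegral_congr fun x => ?_
        rw [lintegral_prod _ (by fun_prop)]
        refine lintegral_congr fun y' => lintegral_congr fun y => ?_
        exact hpt x' x y' y
    _ = ∫⁻ x', g ⟪x', d⟫ * μ {x | orthComp d x ∈ K} ∂μ := by
        refine lintegral_congr_ae ?_
        filter_upwards [ae_inner_ne_zero hd] with x' hx'
        rw [real_inner_comm] at hx'
        -- With `x'` and `y'` fixed, the integral over `x` and `y` is that of `measure_comb` and is
        -- free of `y'`.
        rw [lintegral_lintegral_swap (by fun_prop)]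
        have : ∀ y', ∫⁻ x, ∫⁻ y, g ⟪x', d⟫ *
            K.indicator 1 (orthComp d (⟪y', d⟫ • x - ⟪x', d⟫ • y)) ∂μ ∂μ =
            g ⟪x', d⟫ * μ {x | orthComp d x ∈ K} := fun y' => by
          rw [← measure_comb hK hcone (t := ⟪y', d⟫) hx', ← lintegral_const_mul _ (by fun_prop)]
          refine lintegral_congr fun x => ?_
          rw [lintegral_const_mul _ (by fun_prop)]
        simp_rw [this]
        simp
    _ = _ := lintegral_mul_const _ (by fun_prop)

end Gaussian

/-! ### First absolute moments of Gaussian linear functionals. -/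

section GaussianMoments

lemma integral_abs_gaussianReal : ∫ x, |x| ∂(gaussianReal 0 1) = √(2 / Real.pi) := by
  rw [integral_gaussianReal_eq_integral_smul one_ne_zero]
  have h1 : ∀ x : ℝ, gaussianPDFReal 0 1 x • |x| =
      (√(2 * Real.pi))⁻¹ * (|x| * Real.exp (-(1 / 2) * |x| ^ 2)) := fun x => by
    simp only [gaussianPDFReal, NNReal.coe_one, mul_one, sub_zero, smul_eq_mul, sq_abs]
    ring_nf
  simp_rw [h1]
  rw [integral_const_mul, integral_comp_abs (f := fun x => x * Real.exp (-(1 / 2) * x ^ 2))]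
  have h2 := integral_rpow_mul_exp_neg_mul_rpow (p := 2) (q := 1) (b := 1 / 2) (by norm_num)
    (by norm_num) (by norm_num)
  simp only [Real.rpow_one, Real.rpow_ofNat] at h2
  rw [h2]
  norm_num [Real.rpow_neg_one]
  have h3 : √(2 : ℝ) * √2 = 2 := Real.mul_self_sqrt (by norm_num)
  have h4 : √Real.pi ≠ 0 := (Real.sqrt_pos.2 Real.pi_pos).ne'
  have h5 : √(2 : ℝ) ≠ 0 := by positivity
  field_simp
  linear_combination -h3

variable {E : Type*} [NormedAddCommGroup E] [InnerProductSpace ℝ E] [FiniteDimensional ℝ E]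
  [MeasurableSpace E] [BorelSpace E]

@[fun_prop]
lemma integrable_inner_stdGaussian (d : E) : Integrable (fun x => ⟪x, d⟫) (stdGaussian E) :=
  (IsGaussian.integrable_id (μ := stdGaussian E)).inner_const d

lemma map_inner_stdGaussian (d : E) :
    (stdGaussian E).map (fun x => ⟪x, d⟫) = (gaussianReal 0 1).map (‖d‖ * ·) := by
  have h : (fun x => ⟪x, d⟫) = ⇑(innerSL ℝ d) := by
    ext x; simp [real_inner_comm]
  rw [h, IsGaussian.map_eq_gaussianReal, integral_strongDual_stdGaussian,
    variance_dual_stdGaussian, innerSL_apply_norm, gaussianReal_map_const_mul]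
  congr 1
  · simp
  · ext
    simp

lemma integral_abs_inner (d : E) :
    ∫ x, |⟪x, d⟫| ∂(stdGaussian E) = ‖d‖ * √(2 / Real.pi) := by
  rw [← integral_map (φ := fun x : E => ⟪x, d⟫) (f := fun r => |r|) (by fun_prop) (by fun_prop),
    map_inner_stdGaussian, integral_map (by fun_prop) (by fun_prop)]
  simp_rw [abs_mul, abs_norm]
  rw [integral_const_mul, integral_abs_gaussianReal]

lemma integral_inner_stdGaussian (d : E) : ∫ x, ⟪x, d⟫ ∂(stdGaussian E) = 0 := by
  have := integral_strongDual_stdGaussian (E := E) (innerSL ℝ d)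
  simpa [real_inner_comm] using this

lemma lintegral_neg_inner (d : E) :
    ∫⁻ x, ENNReal.ofReal (-⟪x, d⟫) ∂(stdGaussian E) =
      ENNReal.ofReal (‖d‖ / √(2 * Real.pi)) := by
  have h1 : ∀ r : ℝ, ENNReal.ofReal (-r) = ENNReal.ofReal ((|r| - r) / 2) := fun r => by
    rcases le_total 0 r with h | h
    · rw [abs_of_nonneg h, ENNReal.ofReal_of_nonpos (by linarith)]; simp
    · rw [abs_of_nonpos h]; congr 1; ring
  simp_rw [h1]
  have h2 := (integrable_inner_stdGaussian d).abs
  rw [← ofReal_integral_eq_lintegral_ofReal, integral_div, integral_sub h2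
    (integrable_inner_stdGaussian d), integral_abs_inner, integral_inner_stdGaussian]
  · congr 1
    rw [Real.sqrt_div (by norm_num), Real.sqrt_mul (by norm_num)]
    have h3 : √(2 : ℝ) ≠ 0 := by positivity
    have h4 : √Real.pi ≠ 0 := (Real.sqrt_pos.2 Real.pi_pos).ne'
    have h5 : √(2 : ℝ) * √2 = 2 := Real.mul_self_sqrt (by norm_num)
    field_simp
    linear_combination ‖d‖ * h5
  · exact (h2.sub (integrable_inner_stdGaussian d)).div_const 2
  · filter_upwards with x
    have := le_abs_self ⟪x, d⟫
    simp only [Pi.zero_apply]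
    linarith

end GaussianMoments

/-! ### Probability and mean horizontal extent of a single edge. -/

section Edges

variable {E : Type*} [NormedAddCommGroup E] [InnerProductSpace ℝ E] {ι : Type*}

/-- The pairs along which `(v a, v b)` projects to an edge of the shadow of the family `v`. -/
def edgeSet (v : ι → E) (a b : ι) : Set (E × E) :=
  {p | IsEdge (fun i => ⟪p.1, v i⟫) (fun i => ⟪p.2, v i⟫) a b}

/-- The pairs in general position with respect to the family `v`. -/
def genericSet (v : ι → E) : Set (E × E) :=
  {p | Generic (fun i => ⟪p.1, v i⟫) (fun i => ⟪p.2, v i⟫)}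

/-- The vectors whose minimum over the family `v` is attained exactly on the edge `(a, b)`, among
the vectors orthogonal to the edge. -/
def edgeCone (v : ι → E) (a b : ι) : Set E :=
  {w | ∀ c, c ≠ a → c ≠ b → 0 < ⟪w, v c - v a⟫}

/-- The orientation determinant of `a, b, c` equals `⟪orthDir (v a - v b) p, v c - v a⟫`, so the
pair `p` enters only through `orthDir`. -/
lemma mem_edgeSet_iff (v : ι → E) {a b : ι} (hab : a ≠ b) (p : E × E) :
    p ∈ edgeSet v a b ↔ orthDir (v a - v b) p ∈ edgeCone v a b := by
  have h : ∀ c, cross (fun i => ⟪p.1, v i⟫) (fun i => ⟪p.2, v i⟫) a b c =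
      ⟪orthDir (v a - v b) p, v c - v a⟫ := fun c => by
    simp only [cross, orthDir, inner_sub_left, inner_sub_right, real_inner_smul_left]
    ring
  unfold edgeSet IsEdge edgeCone
  simp only [Set.mem_ofPred_eq, h]
  exact and_iff_right hab

lemma edgeSet_self (v : ι → E) (a : ι) : edgeSet v a a = ∅ := by
  ext p; simp [edgeSet, IsEdge]

lemma smul_mem_edgeCone (v : ι → E) (a b : ι) (r : ℝ) (hr : 0 < r) (w : E) :
    r • w ∈ edgeCone v a b ↔ w ∈ edgeCone v a b := by
  unfold edgeCone
  simp only [Set.mem_ofPred_eq, real_inner_smul_left, mul_pos_iff_of_pos_left hr]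

variable [FiniteDimensional ℝ E] [MeasurableSpace E] [BorelSpace E]

lemma measurableSet_edgeCone [Countable ι] (v : ι → E) (a b : ι) :
    MeasurableSet (edgeCone v a b) := by
  unfold edgeCone
  have : ∀ c, MeasurableSet {w : E | 0 < ⟪w, v c - v a⟫} := fun c =>
    measurableSet_lt measurable_const (by fun_prop)
  measurability

lemma measurableSet_edgeSet [Countable ι] (v : ι → E) (a b : ι) :
    MeasurableSet (edgeSet v a b) := by
  by_cases hab : a = b
  · rw [hab, edgeSet_self]; exact MeasurableSet.empty
  · have : edgeSet v a b = orthDir (v a - v b) ⁻¹' edgeCone v a b := by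
      ext p; exact mem_edgeSet_iff v hab p
    rw [this]
    exact measurable_orthDir _ (measurableSet_edgeCone v a b)

/-- The probability of the edge `(a, b)` of the shadow is an external angle. -/
theorem prod_edgeSet [Countable ι] {v : ι → E} (hv : Function.Injective v) {a b : ι}
    (hab : a ≠ b) :
    (stdGaussian E).prod (stdGaussian E) (edgeSet v a b) =
      stdGaussian E {x | orthComp (v a - v b) x ∈ edgeCone v a b} := by
  have hd : v a - v b ≠ 0 := sub_ne_zero.2 (hv.ne hab)
  have h := lintegral_mul_indicator_orthDir hd (measurableSet_edgeCone v a b)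
    (smul_mem_edgeCone v a b) (g := fun _ => 1) measurable_const
  simp only [one_mul, lintegral_one, measure_univ] at h
  rw [← h, ← lintegral_indicator_one (measurableSet_edgeSet v a b)]
  refine lintegral_congr fun p => ?_
  by_cases hp : p ∈ edgeSet v a b
  · rw [Set.indicator_of_mem hp, Set.indicator_of_mem ((mem_edgeSet_iff v hab p).1 hp)]; rfl
  · rw [Set.indicator_of_notMem hp,
      Set.indicator_of_notMem (fun h => hp ((mem_edgeSet_iff v hab p).2 h))]

open Classical in
/-- The horizontal extent of a lower edge of the shadow has mean proportional to the length of the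
edge and to its probability. -/
theorem lintegral_edge [Countable ι] {v : ι → E} (hv : Function.Injective v) (a b : ι) :
    ∫⁻ p, (if p ∈ edgeSet v a b then ENNReal.ofReal (⟪p.1, v b⟫ - ⟪p.1, v a⟫) else 0)
      ∂((stdGaussian E).prod (stdGaussian E)) =
    ENNReal.ofReal (‖v a - v b‖ / √(2 * Real.pi)) *
      (stdGaussian E).prod (stdGaussian E) (edgeSet v a b) := by
  by_cases hab : a = b
  · subst hab; simp [edgeSet_self]
  have hd : v a - v b ≠ 0 := sub_ne_zero.2 (hv.ne hab)
  rw [prod_edgeSet hv hab, ← lintegral_neg_inner, ← lintegral_mul_indicator_orthDir hd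
    (measurableSet_edgeCone v a b) (smul_mem_edgeCone v a b) (g := fun r => ENNReal.ofReal (-r))
    (by fun_prop)]
  refine lintegral_congr fun p => ?_
  by_cases hp : p ∈ edgeSet v a b
  · rw [if_pos hp, Set.indicator_of_mem ((mem_edgeSet_iff v hab p).1 hp), inner_sub_right]
    simp
  · rw [if_neg hp, Set.indicator_of_notMem (fun h => hp ((mem_edgeSet_iff v hab p).2 h)), mul_zero]

end Edges

/-! ### From shadows to edge counts, and the length-weighted edge identity. -/

section Shadows

variable {E : Type*} [NormedAddCommGroup E] [InnerProductSpace ℝ E] {ι : Type*}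

lemma cross_eq_inner (v : ι → E) (p : E × E) (a b c : ι) :
    cross (fun i => ⟪p.1, v i⟫) (fun i => ⟪p.2, v i⟫) a b c =
      ⟪⟪p.1, v a - v b⟫ • (v a - v c) - ⟪p.1, v a - v c⟫ • (v a - v b), p.2⟫ := by
  rw [real_inner_comm]
  simp only [cross, inner_sub_right, real_inner_smul_right]
  ring

/-- Three distinct points of a sphere are not collinear. -/
lemma smul_sub_smul_ne_zero {x y z : E} (hy : ‖x‖ = ‖y‖) (hz : ‖x‖ = ‖z‖) (hxz : x ≠ z)
    (hyz : y ≠ z) {r s : ℝ} (hr : r ≠ 0) : r • (x - z) - s • (x - y) ≠ 0 := by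
  intro h
  have h1 : z = x - (s / r) • (x - y) := by
    have h2 : x - z = (s / r) • (x - y) := by
      rw [sub_eq_zero] at h
      rw [div_eq_inv_mul, mul_smul, ← h, smul_smul, inv_mul_cancel₀ hr, one_smul]
    rw [← h2]; abel
  set l := s / r
  have h3 : ‖z‖ ^ 2 = ‖x‖ ^ 2 - 2 * (l * ⟪x, x - y⟫) + l ^ 2 * ‖x - y‖ ^ 2 := by
    rw [h1, norm_sub_sq_real, real_inner_smul_right, norm_smul, mul_pow, Real.norm_eq_abs, sq_abs]
  have h4 : 2 * ⟪x, x - y⟫ = ‖x - y‖ ^ 2 := by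
    rw [norm_sub_sq_real, inner_sub_right, real_inner_self_eq_norm_sq, ← hy]; ring
  have h5 : l * (l - 1) * ‖x - y‖ ^ 2 = 0 := by
    rw [← hz] at h3
    linear_combination l * h4 - h3
  rcases mul_eq_zero.1 h5 with h6 | h6
  · rcases mul_eq_zero.1 h6 with h7 | h7
    · rw [h7] at h1; exact hxz (by simp [h1])
    · rw [sub_eq_zero.1 h7] at h1; exact hyz (by simp [h1])
  · have : x - y = 0 := by simpa using h6
    rw [this] at h1; exact hxz (by simp [h1])

/-- The maximum of the linear functional `u` over the family `v`. -/
def supportFn [Fintype ι] [Nonempty ι] (v : ι → E) (u : E) : ℝ :=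
  Finset.univ.sup' Finset.univ_nonempty fun i => ⟪u, v i⟫

lemma le_supportFn [Fintype ι] [Nonempty ι] (v : ι → E) (u : E) (i : ι) :
    ⟪u, v i⟫ ≤ supportFn v u :=
  Finset.le_sup' (fun i => ⟪u, v i⟫) (Finset.mem_univ i)

lemma exists_supportFn_eq [Fintype ι] [Nonempty ι] (v : ι → E) (u : E) :
    ∃ i, supportFn v u = ⟪u, v i⟫ := by
  obtain ⟨i, -, hi⟩ := Finset.exists_mem_eq_sup' Finset.univ_nonempty fun i => ⟪u, v i⟫
  exact ⟨i, hi⟩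

lemma exists_orthonormalizePair_eq (p : E × E) : ∃ κ : ℝ, orthonormalizePair p =
    (‖p.1‖⁻¹ • p.1, ‖p.2 - κ • p.1‖⁻¹ • (p.2 - κ • p.1)) := by
  refine ⟨⟪unitVector p.1, p.2⟫ * ‖p.1‖⁻¹, ?_⟩
  simp [orthonormalizePair, unitVector, smul_smul]

/-- Gram-Schmidt is a triangular change of basis whose diagonal entries are positive at a generic
pair, so it preserves orientation. -/
lemma cross_orthonormalizePair (v : ι → E) {p : E × E} (hp : p ∈ genericSet v) {a b c : ι}
    (hab : a ≠ b) (hac : a ≠ c) (hbc : b ≠ c) : ∃ r : ℝ, 0 < r ∧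
      cross (fun i => ⟪(orthonormalizePair p).1, v i⟫)
        (fun i => ⟪(orthonormalizePair p).2, v i⟫) a b c =
      r * cross (fun i => ⟪p.1, v i⟫) (fun i => ⟪p.2, v i⟫) a b c := by
  obtain ⟨κ, hκ⟩ := exists_orthonormalizePair_eq p
  have hne := hp.2 a b c hab hac hbc
  have h1 : 0 < ‖p.1‖ := by
    rw [norm_pos_iff]; intro h
    exact hne (by simp [cross, h])
  have h2 : 0 < ‖p.2 - κ • p.1‖ := by
    rw [norm_pos_iff, sub_ne_zero]; intro h
    refine hne ?_
    simp only [cross, h, real_inner_smul_left]; ring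
  refine ⟨‖p.1‖⁻¹ * ‖p.2 - κ • p.1‖⁻¹, by positivity, ?_⟩
  rw [hκ]
  simp only [cross, real_inner_smul_left, inner_sub_left]
  ring

lemma orthonormalizePair_mem_edgeSet (v : ι → E) {p : E × E} (hp : p ∈ genericSet v) (a b : ι) :
    orthonormalizePair p ∈ edgeSet v a b ↔ p ∈ edgeSet v a b := by
  refine and_congr_right fun hab => forall_congr' fun c => imp_congr_right fun hca =>
    imp_congr_right fun hcb => ?_
  obtain ⟨r, hr, h⟩ := cross_orthonormalizePair v hp hab hca.symm hcb.symm
  rw [h, mul_pos_iff_of_pos_left hr]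

lemma orthonormalizePair_mem_genericSet (v : ι → E) {p : E × E} (hp : p ∈ genericSet v) :
    orthonormalizePair p ∈ genericSet v := by
  refine ⟨fun a b hab => ?_, fun a b c hab hac hbc => ?_⟩
  · have h := hp.1 a b hab
    have h1 : ‖p.1‖ ≠ 0 := by
      rw [norm_ne_zero_iff]; intro h0
      exact h (by simp [h0])
    simpa [orthonormalizePair, unitVector, real_inner_smul_left, h1] using h
  · obtain ⟨r, hr, h⟩ := cross_orthonormalizePair v hp hab hac hbc
    rw [h]
    exact mul_ne_zero hr.ne' (hp.2 a b c hab hac hbc)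

/-- The number of edges of the shadow of the family `v`. -/
def edgeCount [Fintype ι] (v : ι → E) (p : E × E) : ℝ :=
  ∑ e : ι × ι, (edgeSet v e.1 e.2).indicator 1 p

lemma shadowSize_eq_edgeCount [Fintype ι] [Nontrivial ι] (v : ι → E) {p : E × E}
    (hp : p ∈ genericSet v) :
    (shadowSize (convexHull ℝ (Set.range v)) p.1 p.2 : ℝ) = edgeCount v p := by
  classical
  have h1 : shadowMap p.1 p.2 '' convexHull ℝ (Set.range v) =
      convexHull ℝ (Set.range (point (fun i => ⟪p.1, v i⟫) (fun i => ⟪p.2, v i⟫))) := by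
    rw [(shadowMap p.1 p.2).image_convexHull, ← Set.range_comp]
    rfl
  rw [shadowSize, h1, ncard_extremePoints hp, edgeCount, Finset.card_filter]
  push_cast
  refine Finset.sum_congr rfl fun e _ => ?_
  by_cases he : p ∈ edgeSet v e.1 e.2
  · rw [Set.indicator_of_mem he]; exact if_pos he
  · rw [Set.indicator_of_notMem he]; exact if_neg he

variable [FiniteDimensional ℝ E] [MeasurableSpace E] [BorelSpace E]

lemma measurableSet_genericSet [Countable ι] (v : ι → E) : MeasurableSet (genericSet v) := by
  have h1 : ∀ a b, MeasurableSet {p : E × E | ⟪p.1, v a⟫ ≠ ⟪p.1, v b⟫} := fun a b =>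
    (measurableSet_eq_fun (by fun_prop) (by fun_prop)).compl
  have h2 : ∀ a b c, MeasurableSet
      {p : E × E | cross (fun i => ⟪p.1, v i⟫) (fun i => ⟪p.2, v i⟫) a b c ≠ 0} := fun a b c => by
    unfold cross
    exact (measurableSet_eq_fun (by fun_prop) (by fun_prop)).compl
  have : genericSet v =
      (⋂ (a) (b) (_ : a ≠ b), {p : E × E | ⟪p.1, v a⟫ ≠ ⟪p.1, v b⟫}) ∩
      ⋂ (a) (b) (c) (_ : a ≠ b) (_ : a ≠ c) (_ : b ≠ c),
        {p : E × E | cross (fun i => ⟪p.1, v i⟫) (fun i => ⟪p.2, v i⟫) a b c ≠ 0} := by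
    ext p; simp [genericSet, Generic]
  rw [this]
  refine MeasurableSet.inter ?_ ?_
  · exact .iInter fun a => .iInter fun b => .iInter fun _ => h1 a b
  · exact .iInter fun a => .iInter fun b => .iInter fun c => .iInter fun _ => .iInter fun _ =>
      .iInter fun _ => h2 a b c

/-- For almost every first vector all abscissae differ. Each collinearity is then a linear equation
in the second vector, nontrivial because three points of a sphere are not collinear. -/
lemma ae_mem_genericSet [Countable ι] {v : ι → E} (hv : Function.Injective v)
    (hs : ∀ a b, ‖v a‖ = ‖v b‖) :
    ∀ᵐ p ∂((stdGaussian E).prod (stdGaussian E)), p ∈ genericSet v := by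
  refine (Measure.ae_prod_iff_ae_ae (measurableSet_genericSet v)).2 ?_
  have h1 : ∀ᵐ x ∂(stdGaussian E), ∀ a b, a ≠ b → ⟪x, v a - v b⟫ ≠ 0 := by
    simp_rw [ae_all_iff]
    intro a b hab
    filter_upwards [ae_inner_ne_zero (sub_ne_zero.2 (hv.ne hab))] with x hx
    rwa [real_inner_comm]
  filter_upwards [h1] with x hx
  have h2 : ∀ᵐ y ∂(stdGaussian E), ∀ a b c, a ≠ b → a ≠ c → b ≠ c →
      ⟪⟪x, v a - v b⟫ • (v a - v c) - ⟪x, v a - v c⟫ • (v a - v b), y⟫ ≠ 0 := by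
    simp_rw [ae_all_iff]
    intro a b c hab hac hbc
    exact ae_inner_ne_zero (smul_sub_smul_ne_zero (hs a b) (hs a c) (hv.ne hac) (hv.ne hbc)
      (hx a b hab))
  filter_upwards [h2] with y hy
  refine ⟨fun a b hab h => hx a b hab ?_, fun a b c hab hac hbc => ?_⟩
  · rw [inner_sub_right, sub_eq_zero]; exact h
  · have := cross_eq_inner v (x, y) a b c
    simp only at this
    simp only [this]
    exact hy a b c hab hac hbc

lemma measurable_edgeCount [Fintype ι] (v : ι → E) : Measurable (edgeCount v) := by
  unfold edgeCount
  exact Finset.measurable_sum _ fun e _ => measurable_one.indicator (measurableSet_edgeSet v _ _)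

lemma integrable_edgeCount [Fintype ι] (v : ι → E) (μ : Measure (E × E)) [IsFiniteMeasure μ] :
    Integrable (edgeCount v) μ := by
  unfold edgeCount
  exact integrable_finsetSum _ fun e _ =>
    (integrable_const (1 : ℝ)).indicator (measurableSet_edgeSet v _ _)

section Expectation

variable [Fintype ι] [Nontrivial ι] {v : ι → E}

lemma shadowSize_ae_eq (hv : Function.Injective v) (hs : ∀ a b, ‖v a‖ = ‖v b‖) :
    (fun p : E × E => (shadowSize (convexHull ℝ (Set.range v)) p.1 p.2 : ℝ))
      =ᵐ[uniformOrthonormalPair E] edgeCount v := by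
  have h : ∀ᵐ p ∂(uniformOrthonormalPair E), p ∈ genericSet v := by
    unfold uniformOrthonormalPair
    refine (ae_map_iff measurable_orthonormalizePair.aemeasurable
      (measurableSet_genericSet v)).2 ?_
    filter_upwards [ae_mem_genericSet hv hs] with p hp
    exact orthonormalizePair_mem_genericSet v hp
  filter_upwards [h] with p hp using shadowSize_eq_edgeCount v hp

theorem integrable_shadowSize (hv : Function.Injective v) (hs : ∀ a b, ‖v a‖ = ‖v b‖) :
    Integrable (fun p : E × E => (shadowSize (convexHull ℝ (Set.range v)) p.1 p.2 : ℝ))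
      (uniformOrthonormalPair E) :=
  (integrable_edgeCount v _).congr (shadowSize_ae_eq hv hs).symm

/-- The probability that `(v a, v b)` projects to an edge of the random shadow. -/
def edgeProb (v : ι → E) (a b : ι) : ℝ :=
  ((stdGaussian E).prod (stdGaussian E)).real (edgeSet v a b)

omit [Fintype ι] [Nontrivial ι] [BorelSpace E] in
lemma edgeProb_nonneg (a b : ι) : 0 ≤ edgeProb v a b := measureReal_nonneg

theorem expectedShadowSize_eq_sum (hv : Function.Injective v) (hs : ∀ a b, ‖v a‖ = ‖v b‖) :
    expectedShadowSize (convexHull ℝ (Set.range v)) = ∑ e : ι × ι, edgeProb v e.1 e.2 := by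
  rw [expectedShadowSize, integral_congr_ae (shadowSize_ae_eq hv hs), uniformOrthonormalPair,
    integral_map measurable_orthonormalizePair.aemeasurable
      (measurable_edgeCount v).aestronglyMeasurable]
  have h : (fun p => edgeCount v (orthonormalizePair p))
      =ᵐ[(stdGaussian E).prod (stdGaussian E)] edgeCount v := by
    filter_upwards [ae_mem_genericSet hv hs] with p hp
    refine Finset.sum_congr rfl fun e _ => ?_
    have := orthonormalizePair_mem_edgeSet v hp e.1 e.2
    by_cases he : p ∈ edgeSet v e.1 e.2
    · rw [Set.indicator_of_mem he, Set.indicator_of_mem (this.2 he)]; rfl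
    · rw [Set.indicator_of_notMem he, Set.indicator_of_notMem (fun h => he (this.1 h))]
  rw [integral_congr_ae h]
  unfold edgeCount
  refine (integral_finsetSum _ fun e _ =>
    (integrable_const (1 : ℝ)).indicator (measurableSet_edgeSet v _ _)).trans ?_
  exact Finset.sum_congr rfl fun e _ => integral_indicator_one (measurableSet_edgeSet v _ _)

omit [Nontrivial ι] in
@[fun_prop]
lemma measurable_supportFn [Nonempty ι] (v : ι → E) : Measurable (supportFn v) := by
  have : supportFn v = Finset.univ.sup' Finset.univ_nonempty fun i u => ⟪u, v i⟫ := by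
    ext u; simp [supportFn, Finset.sup'_apply]
  rw [this]
  exact Finset.measurable_sup' _ fun i _ => by fun_prop

omit [Nontrivial ι] in
@[fun_prop]
lemma integrable_supportFn [Nonempty ι] (v : ι → E) :
    Integrable (supportFn v) (stdGaussian E) := by
  refine Integrable.mono' (g := fun u => ∑ i, |⟪u, v i⟫|)
    (integrable_finsetSum _ fun i _ => (integrable_inner_stdGaussian _).abs)
    (measurable_supportFn v).aestronglyMeasurable (.of_forall fun u => ?_)
  obtain ⟨i, hi⟩ := exists_supportFn_eq v u
  rw [hi, Real.norm_eq_abs]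
  exact Finset.single_le_sum (f := fun i => |⟪u, v i⟫|) (fun i _ => abs_nonneg _)
    (Finset.mem_univ i)

omit [Nontrivial ι] in
lemma integrable_supportFn_neg [Nonempty ι] (v : ι → E) :
    Integrable (fun u => supportFn v (-u)) (stdGaussian E) := by
  have h := integrable_supportFn v
  rw [← stdGaussian_map (LinearIsometryEquiv.neg ℝ (E := E))] at h
  exact h.comp_measurable (by fun_prop)

lemma integral_comp_neg_stdGaussian (f : E → ℝ) :
    ∫ u, f (-u) ∂(stdGaussian E) = ∫ u, f u ∂(stdGaussian E) := by
  have h := stdGaussian_map (LinearIsometryEquiv.neg ℝ (E := E))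
  conv_rhs => rw [← h]
  exact (integral_map_equiv (Homeomorph.neg E).toMeasurableEquiv f).symm

/-- The total length of the edges of `v`, weighted by the probability to be seen in the random
shadow, is proportional to the mean width of `v`. -/
theorem sum_norm_mul_edgeProb (hv : Function.Injective v) (hs : ∀ a b, ‖v a‖ = ‖v b‖) :
    ∑ e : ι × ι, ‖v e.1 - v e.2‖ * edgeProb v e.1 e.2 =
      2 * √(2 * Real.pi) * ∫ u, supportFn v u ∂(stdGaussian E) := by
  classical
  set γ := (stdGaussian E).prod (stdGaussian E) with hγ
  have hnn : ∀ u : E, 0 ≤ supportFn v u + supportFn v (-u) := fun u => by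
    obtain ⟨a⟩ : Nonempty ι := inferInstance
    have h1 := le_supportFn v u a
    have h2 := le_supportFn v (-u) a
    rw [inner_neg_left] at h2
    linarith
  have hint : Integrable (fun u : E => supportFn v u + supportFn v (-u)) (stdGaussian E) := by
    exact (integrable_supportFn v).add (integrable_supportFn_neg v)
  -- The shadow projects to an interval of length `supportFn v p.1 + supportFn v (-p.1)`, tiled by
  -- the lower edges. Integration turns the left side into `lintegral_edge` and the right side into
  -- twice the mean support.
  have h1 : ∀ᵐ p ∂γ, ∑ e : ι × ι, (if p ∈ edgeSet v e.1 e.2 then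
      ENNReal.ofReal (⟪p.1, v e.2⟫ - ⟪p.1, v e.1⟫) else 0) =
      ENNReal.ofReal (supportFn v p.1 + supportFn v (-p.1)) := by
    filter_upwards [ae_mem_genericSet hv hs] with p hp
    obtain ⟨b, hb⟩ := exists_supportFn_eq v p.1
    obtain ⟨a, ha⟩ := exists_supportFn_eq v (-p.1)
    have h := sum_lowerEdge hp (a₀ := a) (b₀ := b) (fun c => ?_) (fun c => ?_)
    · rw [hb, ha, inner_neg_left, ← sub_eq_add_neg, ← h]; rfl
    · have := le_supportFn v (-p.1) c
      rw [ha, inner_neg_left, inner_neg_left] at this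
      linarith
    · exact hb ▸ le_supportFn v p.1 c
  have h2 := lintegral_congr_ae h1
  rw [lintegral_finsetSum' _ fun e _ => ?_] at h2
  swap
  · exact (Measurable.ite (measurableSet_edgeSet v _ _) (by fun_prop)
      measurable_const).aemeasurable
  rw [Finset.sum_congr rfl fun e _ => lintegral_edge hv e.1 e.2] at h2
  have h3 : ∫⁻ p, ENNReal.ofReal (supportFn v p.1 + supportFn v (-p.1)) ∂γ =
      ENNReal.ofReal (2 * ∫ u, supportFn v u ∂(stdGaussian E)) := by
    have h4 : (∫⁻ p, ENNReal.ofReal (supportFn v p.1 + supportFn v (-p.1)) ∂γ) =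
        ∫⁻ u, ENNReal.ofReal (supportFn v u + supportFn v (-u)) ∂(stdGaussian E) := by
      rw [lintegral_prod _ (by fun_prop)]
      simp
    rw [h4, ← ofReal_integral_eq_lintegral_ofReal hint (.of_forall hnn),
      integral_add (integrable_supportFn v), integral_comp_neg_stdGaussian, two_mul]
    exact integrable_supportFn_neg v
  rw [h3] at h2
  have h5 := congrArg ENNReal.toReal h2
  rw [ENNReal.toReal_sum (fun e _ => by finiteness), ENNReal.toReal_ofReal] at h5
  · have h6 : 0 < √(2 * Real.pi) := Real.sqrt_pos.2 (by positivity)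
    rw [mul_right_comm, ← h5, Finset.sum_mul]
    refine Finset.sum_congr rfl fun e _ => ?_
    rw [ENNReal.toReal_mul, ENNReal.toReal_ofReal (by positivity)]
    change _ = ‖v e.1 - v e.2‖ / √(2 * Real.pi) * edgeProb v e.1 e.2 * _
    field_simp
  · have := integral_nonneg (μ := stdGaussian E)
      (f := fun u => supportFn v u + supportFn v (-u)) hnn
    rw [integral_add (integrable_supportFn v), integral_comp_neg_stdGaussian] at this
    · linarith
    exact integrable_supportFn_neg v

end Expectation

end Shadows

/-! ### Geometry of permutation matrices and the two comparisons with `meanSupport`. -/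

section Birkhoff

/-- The permutation matrix of `σ` as a vector of `ℝ^(n × n)`. -/
def permVec {n : ℕ} (σ : Equiv.Perm (Fin n)) : EuclideanSpace ℝ (Fin n × Fin n) :=
  WithLp.toLp 2 fun ij : Fin n × Fin n => σ.permMatrix ℝ ij.1 ij.2

variable {n : ℕ}

lemma permVec_apply (σ : Equiv.Perm (Fin n)) (i j : Fin n) :
    permVec σ (i, j) = if σ i = j then 1 else 0 := by
  simp [permVec, Equiv.Perm.permMatrix, PEquiv.toMatrix_apply, Equiv.toPEquiv_apply, eq_comm]

lemma inner_permVec (u : EuclideanSpace ℝ (Fin n × Fin n)) (σ : Equiv.Perm (Fin n)) :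
    ⟪u, permVec σ⟫ = ∑ i, u (i, σ i) := by
  rw [PiLp.inner_apply, Fintype.sum_prod_type]
  simp [permVec_apply]

lemma inner_permVec_permVec (σ τ : Equiv.Perm (Fin n)) :
    ⟪permVec σ, permVec τ⟫ = ((Finset.univ.filter fun i => σ i = τ i).card : ℝ) := by
  rw [inner_permVec, Finset.card_filter]
  simp [permVec_apply]

lemma norm_permVec (σ : Equiv.Perm (Fin n)) : ‖permVec σ‖ = √n := by
  rw [norm_eq_sqrt_real_inner, inner_permVec_permVec]
  simp

lemma norm_permVec_sub_sq (σ τ : Equiv.Perm (Fin n)) :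
    ‖permVec σ - permVec τ‖ ^ 2 = 2 * ((Finset.univ.filter fun i => σ i ≠ τ i).card : ℝ) := by
  rw [norm_sub_sq_real, norm_permVec, norm_permVec, inner_permVec_permVec,
    Real.sq_sqrt (Nat.cast_nonneg n)]
  have h := Finset.card_filter_add_card_filter_not (s := Finset.univ) (fun i => σ i = τ i)
  rw [Finset.card_univ, Fintype.card_fin] at h
  have h' : (n : ℝ) = ((Finset.univ.filter fun i => σ i = τ i).card : ℝ) +
      ((Finset.univ.filter fun i => σ i ≠ τ i).card : ℝ) := by exact_mod_cast h.symm
  rw [h']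
  ring

lemma two_le_norm_permVec_sub {σ τ : Equiv.Perm (Fin n)} (h : σ ≠ τ) :
    2 ≤ ‖permVec σ - permVec τ‖ := by
  obtain ⟨i, hi⟩ : ∃ i, σ i ≠ τ i := by
    by_contra! hcon
    exact h (Equiv.ext hcon)
  have h1 : 1 < (Finset.univ.filter fun i => σ i ≠ τ i).card := by
    -- Disagreement at `i` forces another one at the place where `σ` takes the value `τ i`.
    refine Finset.one_lt_card.2 ⟨i, by simpa using hi, σ.symm (τ i), ?_, ?_⟩
    · simp only [Finset.mem_filter, Finset.mem_univ, true_and, Equiv.apply_symm_apply]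
      intro h2
      exact hi (by conv_lhs => rw [τ.injective h2]
                   simp)
    · intro h2
      exact hi (by conv_lhs => rw [h2]
                   simp)
  have h2 := norm_permVec_sub_sq σ τ
  have h3 : (2 : ℝ) ≤ ((Finset.univ.filter fun i => σ i ≠ τ i).card : ℝ) := by exact_mod_cast h1
  nlinarith [norm_nonneg (permVec σ - permVec τ)]

lemma norm_permVec_sub_le (σ τ : Equiv.Perm (Fin n)) :
    ‖permVec σ - permVec τ‖ ≤ √(2 * n) := by
  refine Real.le_sqrt_of_sq_le ?_
  rw [norm_permVec_sub_sq]
  have : (Finset.univ.filter fun i => σ i ≠ τ i).card ≤ n :=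
    (Finset.card_le_univ _).trans_eq (Fintype.card_fin n)
  have : ((Finset.univ.filter fun i => σ i ≠ τ i).card : ℝ) ≤ n := by exact_mod_cast this
  linarith

lemma permVec_injective : Function.Injective (permVec (n := n)) := by
  intro σ τ h
  by_contra hne
  have := two_le_norm_permVec_sub hne
  rw [h, sub_self, norm_zero] at this
  norm_num at this

lemma norm_permVec_eq (σ τ : Equiv.Perm (Fin n)) : ‖permVec σ‖ = ‖permVec τ‖ := by
  rw [norm_permVec, norm_permVec]

lemma nontrivial_perm (hn : 2 ≤ n) : Nontrivial (Equiv.Perm (Fin n)) := by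
  have : Nontrivial (Fin n) := Fin.nontrivial_iff_two_le.2 hn
  infer_instance

/-- The mean of the maximal weight of a permutation for independent standard Gaussian weights. -/
def meanSupport (n : ℕ) : ℝ :=
  ∫ u, supportFn (permVec (n := n)) u ∂(stdGaussian (EuclideanSpace ℝ (Fin n × Fin n)))

lemma integral_inner_sq {E : Type*} [NormedAddCommGroup E] [InnerProductSpace ℝ E]
    [FiniteDimensional ℝ E] [MeasurableSpace E] [BorelSpace E] (d : E) :
    Integrable (fun x => ⟪d, x⟫ ^ 2) (stdGaussian E) ∧
      ∫ x, ⟪d, x⟫ ^ 2 ∂(stdGaussian E) = ‖d‖ ^ 2 := by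
  have h1 : MemLp (fun x => ⟪d, x⟫) 2 (stdGaussian E) :=
    (IsGaussian.memLp_two_id (μ := stdGaussian E)).const_inner d
  refine ⟨h1.integrable_sq, ?_⟩
  have h2 := variance_dual_stdGaussian (innerSL ℝ d)
  rw [innerSL_apply_norm, variance_of_integral_eq_zero (by fun_prop)
    (integral_strongDual_stdGaussian _)] at h2
  simpa using h2

lemma integral_norm_stdGaussian_le :
    ∫ u, ‖u‖ ∂(stdGaussian (EuclideanSpace ℝ (Fin n × Fin n))) ≤ n := by
  rcases Nat.eq_zero_or_pos n with rfl | hn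
  · have : ∀ u : EuclideanSpace ℝ (Fin 0 × Fin 0), ‖u‖ = 0 := fun u => by
      rw [Subsingleton.elim u 0, norm_zero]
    simp [this]
  have hn' : (0 : ℝ) < n := by exact_mod_cast hn
  have h1 : ∀ u : EuclideanSpace ℝ (Fin n × Fin n), ‖u‖ ^ 2 =
      ∑ i, ⟪EuclideanSpace.basisFun _ ℝ i, u⟫ ^ 2 := fun u => by
    simp [EuclideanSpace.real_norm_sq_eq, EuclideanSpace.inner_single_left]
  have h2 : Integrable (fun u => ‖u‖ ^ 2) (stdGaussian (EuclideanSpace ℝ (Fin n × Fin n))) := by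
    simp_rw [h1]
    exact integrable_finsetSum _ fun i _ => (integral_inner_sq _).1
  have h3 : ∫ u, ‖u‖ ^ 2 ∂(stdGaussian (EuclideanSpace ℝ (Fin n × Fin n))) = n * n := by
    simp_rw [h1]
    rw [integral_finsetSum _ fun i _ => (integral_inner_sq _).1]
    simp [(integral_inner_sq _).2]
  calc ∫ u, ‖u‖ ∂(stdGaussian (EuclideanSpace ℝ (Fin n × Fin n)))
      -- The inequality of arithmetic and geometric means, balanced for a mean square norm of `n *
      -- n`.
      ≤ ∫ u, (‖u‖ ^ 2 / n + n) / 2 ∂(stdGaussian (EuclideanSpace ℝ (Fin n × Fin n))) := by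
        refine integral_mono (IsGaussian.integrable_id (μ := stdGaussian _)).norm
          (((h2.div_const _).add (integrable_const _)).div_const _) fun u => ?_
        simp only
        rw [le_div_iff₀ (by norm_num), ← sub_nonneg]
        have : ‖u‖ ^ 2 / n + n - ‖u‖ * 2 = (‖u‖ - n) ^ 2 / n := by field_simp; ring
        rw [this]; positivity
    _ = n := by
        rw [integral_div, integral_add (h2.div_const _) (integrable_const _), integral_div, h3]
        simp

lemma meanSupport_le : meanSupport n ≤ √n * n := by
  calc meanSupport n
      ≤ ∫ u, √n * ‖u‖ ∂(stdGaussian (EuclideanSpace ℝ (Fin n × Fin n))) := by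
        refine integral_mono (integrable_supportFn _)
          ((IsGaussian.integrable_id (μ := stdGaussian _)).norm.const_mul _) fun u => ?_
        obtain ⟨σ, hσ⟩ := exists_supportFn_eq permVec u
        rw [hσ]
        refine (real_inner_le_norm _ _).trans ?_
        rw [norm_permVec, mul_comm]
    _ ≤ √n * n := by
        rw [integral_const_mul]
        gcongr
        exact integral_norm_stdGaussian_le

lemma expectedShadowSize_birkhoffPolytope (hn : 2 ≤ n) :
    expectedShadowSize (birkhoffPolytope n) =
      ∑ e : Equiv.Perm (Fin n) × Equiv.Perm (Fin n), edgeProb permVec e.1 e.2 := by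
  have := nontrivial_perm hn
  exact expectedShadowSize_eq_sum permVec_injective norm_permVec_eq

lemma sum_norm_mul_edgeProb_permVec (hn : 2 ≤ n) :
    ∑ e : Equiv.Perm (Fin n) × Equiv.Perm (Fin n),
      ‖permVec e.1 - permVec e.2‖ * edgeProb permVec e.1 e.2 =
      2 * √(2 * Real.pi) * meanSupport n := by
  have := nontrivial_perm hn
  exact sum_norm_mul_edgeProb permVec_injective norm_permVec_eq

lemma edgeProb_self {E ι : Type*} [NormedAddCommGroup E] [InnerProductSpace ℝ E]
    [FiniteDimensional ℝ E] [MeasurableSpace E] (v : ι → E) (a : ι) : edgeProb v a a = 0 := by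
  simp [edgeProb, edgeSet_self]

theorem expectedShadowSize_birkhoffPolytope_le (hn : 2 ≤ n) :
    expectedShadowSize (birkhoffPolytope n) ≤ √(2 * Real.pi) * (n : ℝ) ^ (3 / 2 : ℝ) := by
  have h1 : 2 * expectedShadowSize (birkhoffPolytope n) ≤ 2 * √(2 * Real.pi) * meanSupport n := by
    rw [← sum_norm_mul_edgeProb_permVec hn, expectedShadowSize_birkhoffPolytope hn, Finset.mul_sum]
    refine Finset.sum_le_sum fun e _ => ?_
    by_cases he : e.1 = e.2
    · rw [he, edgeProb_self]; simp
    · exact mul_le_mul_of_nonneg_right (two_le_norm_permVec_sub he) (edgeProb_nonneg _ _)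
  have h2 : (n : ℝ) ^ (3 / 2 : ℝ) = √n * n := by
    rw [show (3 / 2 : ℝ) = 1 / 2 + 1 by norm_num, Real.rpow_add (by positivity),
      Real.rpow_one, Real.sqrt_eq_rpow]
  have h3 := mul_le_mul_of_nonneg_left (meanSupport_le (n := n)) (Real.sqrt_nonneg (2 * Real.pi))
  rw [h2]
  linarith

theorem meanSupport_le_expectedShadowSize (hn : 2 ≤ n) :
    2 * √(2 * Real.pi) * meanSupport n ≤
      √(2 * n) * expectedShadowSize (birkhoffPolytope n) := by
  rw [← sum_norm_mul_edgeProb_permVec hn, expectedShadowSize_birkhoffPolytope hn, Finset.mul_sum]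
  exact Finset.sum_le_sum fun e _ =>
    mul_le_mul_of_nonneg_right (norm_permVec_sub_le _ _) (edgeProb_nonneg _ _)

end Birkhoff

/-! ### An upper bound for the Gaussian measure of an obtuse cone. -/

section Cones

variable {E : Type*} [NormedAddCommGroup E] [InnerProductSpace ℝ E]

/-- The set of vectors whose inner products with the family `w` have the signs given by `s`. -/
def signCone (w : Fin 3 → E) (s : Fin 3 → ℝ) : Set E := {x | ∀ j, 0 < s j * ⟪x, w j⟫}

lemma disjoint_signCone (w : Fin 3 → E) {s t : Fin 3 → ℝ} {j : Fin 3} (h : s j * t j < 0) :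
    Disjoint (signCone w s) (signCone w t) := by
  rw [Set.disjoint_left]
  intro x hx hx'
  have h1 := mul_pos (hx j) (hx' j)
  nlinarith [sq_nonneg ⟪x, w j⟫]

variable [FiniteDimensional ℝ E] [MeasurableSpace E] [BorelSpace E]

lemma measurableSet_signCone (w : Fin 3 → E) (s : Fin 3 → ℝ) : MeasurableSet (signCone w s) := by
  have : signCone w s = ⋂ j, {x | 0 < s j * ⟪x, w j⟫} := by ext; simp [signCone]
  rw [this]
  exact .iInter fun j => measurableSet_lt measurable_const (by fun_prop)

/-- The reflection in the hyperplane orthogonal to `d` preserves the standard Gaussian law. -/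
lemma map_reflection_stdGaussian {d : E} (hd : d ≠ 0) :
    (stdGaussian E).map (fun x => orthComp d x - alongComp d x) = stdGaussian E := by
  refine map_stdGaussian_of_adjoint (f' := fun x => orthComp d x - alongComp d x) (by fun_prop)
    (fun x t => ?_) fun x => ?_
  · rw [inner_sub_left, inner_sub_right, orthComp_inner, alongComp_inner]
  · rw [← sq_eq_sq₀ (norm_nonneg _) (norm_nonneg _), ← norm_comp_sq hd x, norm_sub_sq_real]
    have h : ⟪orthComp d x, alongComp d x⟫ = 0 := by
      rw [alongComp, real_inner_smul_right, orthComp_inner_self hd, mul_zero]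
    rw [h]; ring

/-- Reflection in the hyperplane orthogonal to `w k` flips the `k`-th sign. As `⟪w k, w j⟫ ≤ 0`, it
can only increase the other products on the positive cone. -/
lemma measure_signCone_le_reflect {w : Fin 3 → E} (hw : ∀ i, w i ≠ 0)
    (hneg : ∀ i j, i ≠ j → ⟪w i, w j⟫ ≤ 0) (k : Fin 3) :
    stdGaussian E (signCone w 1) ≤
      stdGaussian E (signCone w (fun j => if j = k then -1 else 1)) := by
  conv_rhs => rw [← map_reflection_stdGaussian (hw k)]
  rw [Measure.map_apply (by fun_prop) (measurableSet_signCone w _)]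
  refine measure_mono fun x hx j => ?_
  have hk := hx k
  have hj := hx j
  simp only [Pi.one_apply, one_mul] at hk hj
  rw [inner_sub_left]
  by_cases hjk : j = k
  · subst hjk
    rw [orthComp_inner_self (hw j), alongComp_inner_self (hw j)]
    simpa using hj
  · simp only [if_neg hjk]
    rw [one_mul, orthComp, inner_sub_left, alongComp, real_inner_smul_left]
    have h1 : 0 < ‖w k‖ := norm_pos_iff.2 (hw k)
    have h2 : ⟪x, w k⟫ / ‖w k‖ ^ 2 * ⟪w k, w j⟫ ≤ 0 :=
      mul_nonpos_of_nonneg_of_nonpos (by positivity) (hneg k j (Ne.symm hjk))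
    linarith

lemma measure_signCone_neg (w : Fin 3 → E) :
    stdGaussian E (signCone w (-1)) = stdGaussian E (signCone w 1) := by
  have h := stdGaussian_map (LinearIsometryEquiv.neg ℝ (E := E))
  conv_lhs => rw [← h]
  rw [Measure.map_apply (by fun_prop) (measurableSet_signCone w _)]
  congr 1
  ext x
  simp [signCone]

/-- Three linear functionals that are pairwise nonpositively correlated are simultaneously
positive with probability at most `1 / 5`. -/
theorem measureReal_signCone_le {w : Fin 3 → E} (hw : ∀ i, w i ≠ 0)
    (hneg : ∀ i j, i ≠ j → ⟪w i, w j⟫ ≤ 0) :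
    (stdGaussian E).real (signCone w 1) ≤ 1 / 5 := by
  set μ := stdGaussian E
  -- Five sign patterns: all positive, all negative, and one negative sign in each of three
  -- positions. Their cones are disjoint and none has smaller measure than the positive one.
  let s : Option (Option (Fin 3)) → Fin 3 → ℝ
    | none => 1
    | some none => -1
    | some (some k) => fun j => if j = k then -1 else 1
  have hdisj : Pairwise fun a b => Disjoint (signCone w (s a)) (signCone w (s b)) := by
    have key : ∀ a b, a ≠ b → ∃ j, s a j * s b j < 0 := by
      rintro (_ | _ | k) (_ | _ | l) hab
      · exact absurd rfl hab
      · exact ⟨0, by simp [s]⟩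
      · exact ⟨l, by simp [s]⟩
      · exact ⟨0, by simp [s]⟩
      · exact absurd rfl hab
      · obtain ⟨j, hj⟩ := exists_ne l
        exact ⟨j, by simp [s, hj]⟩
      · exact ⟨k, by simp [s]⟩
      · obtain ⟨j, hj⟩ := exists_ne k
        exact ⟨j, by simp [s, hj]⟩
      · have hkl : k ≠ l := fun h => hab (by rw [h])
        exact ⟨k, by simp [s, hkl]⟩
    intro a b hab
    obtain ⟨j, hj⟩ := key a b hab
    exact disjoint_signCone w hj
  have h1 : ∑ a, μ (signCone w (s a)) ≤ 1 := by
    rw [← measure_univ (μ := μ), ← tsum_fintype (L := .unconditional _)]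
    exact tsum_measure_le_measure_univ
      (fun a => (measurableSet_signCone w (s a)).nullMeasurableSet)
      fun a b hab => (hdisj hab).aedisjoint
  have h2 : ∀ a, μ (signCone w 1) ≤ μ (signCone w (s a)) := by
    rintro (_ | _ | k)
    · exact le_rfl
    · exact (measure_signCone_neg w).ge
    · exact measure_signCone_le_reflect hw hneg k
  have h3 : 5 * μ (signCone w 1) ≤ 1 := by
    refine le_trans ?_ h1
    have := Finset.sum_le_sum fun a (_ : a ∈ Finset.univ) => h2 a
    simpa using this
  have h4 := ENNReal.toReal_mono ENNReal.one_ne_top h3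
  rw [ENNReal.toReal_mul] at h4
  simp only [ENNReal.toReal_ofNat, ENNReal.toReal_one] at h4
  change (μ (signCone w 1)).toReal ≤ 1 / 5
  linarith

end Cones

/-! ### Selecting coordinates of a Gaussian vector. -/

section Coordinates

variable {κ ι : Type*}

/-- The vector of coordinates of `x` selected by `φ`. -/
def reindexVec (φ : κ → ι) (x : EuclideanSpace ℝ ι) : EuclideanSpace ℝ κ :=
  WithLp.toLp 2 fun k => x (φ k)

@[fun_prop]
lemma measurable_reindexVec (φ : κ → ι) : Measurable (reindexVec φ) := by
  unfold reindexVec; fun_prop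

lemma map_reindexVec [Fintype κ] [Fintype ι] {φ : κ → ι} (hφ : Function.Injective φ) :
    (stdGaussian (EuclideanSpace ℝ ι)).map (reindexVec φ) = stdGaussian (EuclideanSpace ℝ κ) := by
  have hnot : ∀ (t : EuclideanSpace ℝ κ) i, i ∉ Set.range φ →
      Function.extend φ t 0 i = 0 := fun t i hi => by
    rw [Function.extend_apply' _ _ _ (fun ⟨k, hk⟩ => hi ⟨k, hk⟩)]; rfl
  refine map_stdGaussian_of_adjoint (f' := fun t => WithLp.toLp 2 (Function.extend φ t 0))
    (by fun_prop) (fun x t => ?_) fun t => ?_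
  · rw [PiLp.inner_apply, PiLp.inner_apply]
    refine Fintype.sum_of_injective φ hφ _ _ (fun i hi => ?_) fun k => ?_
    · simp [hnot t i hi]
    · simp [reindexVec, hφ.extend_apply]
  · rw [EuclideanSpace.norm_eq, EuclideanSpace.norm_eq]
    congr 1
    refine (Fintype.sum_of_injective φ hφ _ _ (fun i hi => ?_) fun k => ?_).symm
    · simp [hnot t i hi]
    · simp [hφ.extend_apply]

lemma integral_comp_of_map_eq {E F : Type*} [MeasurableSpace E] [MeasurableSpace F] {μ : Measure E}
    {ν : Measure F} {f : E → F} (hf : Measurable f) (h : μ.map f = ν) {g : F → ℝ}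
    (hg : Integrable g ν) :
    Integrable (fun x => g (f x)) μ ∧ ∫ x, g (f x) ∂μ = ∫ y, g y ∂ν := by
  subst h
  exact ⟨hg.comp_measurable hf, (integral_map hf.aemeasurable hg.aestronglyMeasurable).symm⟩

end Coordinates

/-! ### Growth of the mean maximal weight with the size of the matrix. -/

section Recursion

variable {n : ℕ}

lemma sum_le_supportFn (u : EuclideanSpace ℝ (Fin n × Fin n)) (σ : Equiv.Perm (Fin n)) :
    ∑ i, u (i, σ i) ≤ supportFn permVec u := by
  rw [← inner_permVec]; exact le_supportFn permVec u σ

/-- The submatrix without the row `0` and the column `j`. -/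
def minorVec (j : Fin (n + 1)) (u : EuclideanSpace ℝ (Fin (n + 1) × Fin (n + 1))) :
    EuclideanSpace ℝ (Fin n × Fin n) :=
  reindexVec (fun ik => (ik.1.succ, j.succAbove ik.2)) u

/-- Exchange of the columns `0` and `1` in all rows except the row `0`. -/
def swapVec (u : EuclideanSpace ℝ (Fin (n + 2) × Fin (n + 2))) :
    EuclideanSpace ℝ (Fin (n + 2) × Fin (n + 2)) :=
  reindexVec (fun ik => (ik.1, if ik.1 = 0 then ik.2 else Equiv.swap 0 1 ik.2)) u

lemma add_supportFn_minorVec_le (j : Fin (n + 1))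
    (u : EuclideanSpace ℝ (Fin (n + 1) × Fin (n + 1))) :
    u (0, j) + supportFn permVec (minorVec j u) ≤ supportFn permVec u := by
  obtain ⟨σ, hσ⟩ := exists_supportFn_eq permVec (minorVec j u)
  rw [hσ, inner_permVec]
  refine le_trans (le_of_eq ?_) (sum_le_supportFn u
    ((finSuccEquiv' 0).trans ((Equiv.optionCongr σ).trans (finSuccEquiv' j).symm)))
  rw [Fin.sum_univ_succ]
  simp only [Equiv.trans_apply, finSuccEquiv'_at]
  congr 1

lemma minorVec_swapVec (u : EuclideanSpace ℝ (Fin (n + 2) × Fin (n + 2))) :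
    minorVec 0 (swapVec u) = minorVec 1 u ∧ minorVec 1 (swapVec u) = minorVec 0 u := by
  have h1 : ∀ k : Fin (n + 1), Equiv.swap (0 : Fin (n + 2)) 1 k.succ =
      Fin.succAbove 1 k := by
    intro k
    refine Fin.cases ?_ (fun k => ?_) k
    · simp
    · rw [Fin.one_succAbove_succ, Equiv.swap_apply_of_ne_of_ne]
      · exact Fin.succ_ne_zero _
      · intro h
        exact Fin.succ_ne_zero k (Fin.succ_injective _ h)
  have h2 : ∀ k : Fin (n + 1), Equiv.swap (0 : Fin (n + 2)) 1 (Fin.succAbove 1 k) =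
      k.succ := fun k => by rw [← h1, Equiv.swap_apply_self]
  constructor <;> ext ⟨i, k⟩ <;> simp [minorVec, swapVec, reindexVec, h1, h2]

lemma swapIndex_injective : Function.Injective fun ik : Fin (n + 2) × Fin (n + 2) =>
    (ik.1, if ik.1 = 0 then ik.2 else Equiv.swap 0 1 ik.2) := by
  rintro ⟨i, k⟩ ⟨i', k'⟩ h
  simp only [Prod.mk.injEq] at h
  obtain ⟨rfl, h⟩ := h
  split_ifs at h with hi
  · rw [h]
  · rw [(Equiv.swap 0 1).injective h]

lemma minorIndex_injective (j : Fin (n + 1)) : Function.Injective fun ik : Fin n × Fin n =>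
    (ik.1.succ, j.succAbove ik.2) := by
  rintro ⟨i, k⟩ ⟨i', k'⟩ h
  simp only [Prod.mk.injEq] at h
  rw [Fin.succ_injective _ h.1, Fin.succAbove_right_injective h.2]

lemma integral_minorVec (j : Fin (n + 1)) :
    Integrable (fun u => supportFn permVec (minorVec j u)) (stdGaussian _) ∧
      ∫ u, supportFn permVec (minorVec j u) ∂(stdGaussian _) = meanSupport n :=
  integral_comp_of_map_eq (measurable_reindexVec _) (map_reindexVec (minorIndex_injective j))
    (integrable_supportFn _)

/-- Choose the larger of the first two entries `a, b` of row `0`, then the best permutation of its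
minor. Swapping these columns in the other rows exchanges the two minors, so together `u` and
`swapVec u` collect both minors and `2 max(a, b) = a + b + |a - b|`. The mean of `|a - b|` is `2 /
√π`, shared by two copies. -/
theorem meanSupport_add_le : meanSupport (n + 1) + 1 / √Real.pi ≤ meanSupport (n + 2) := by
  let d : EuclideanSpace ℝ (Fin (n + 2) × Fin (n + 2)) :=
    EuclideanSpace.single (0, 0) 1 - EuclideanSpace.single (0, 1) 1
  have hd : ∀ u, ⟪u, d⟫ = u (0, 0) - u (0, 1) := fun u => by
    simp [d, inner_sub_right, EuclideanSpace.inner_single_right]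
  have hnorm : ‖d‖ = √2 := by
    rw [norm_eq_sqrt_real_inner, hd]
    simp [d]
    norm_num
  have hpt : ∀ u, ⟪u, EuclideanSpace.single (0, 0) 1⟫ + ⟪u, EuclideanSpace.single (0, 1) 1⟫ +
      (supportFn permVec (minorVec 0 u) + supportFn permVec (minorVec 1 u)) + |⟪u, d⟫| ≤
      supportFn permVec u + supportFn (permVec (n := n + 2)) (swapVec u) := fun u => by
    have h1 := add_supportFn_minorVec_le 0 u
    have h2 := add_supportFn_minorVec_le 1 u
    have h3 := add_supportFn_minorVec_le 0 (swapVec u)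
    have h4 := add_supportFn_minorVec_le 1 (swapVec u)
    rw [(minorVec_swapVec u).1] at h3
    rw [(minorVec_swapVec u).2] at h4
    have h5 : ∀ j, swapVec u (0, j) = u (0, j) := fun j => by simp [swapVec, reindexVec]
    rw [h5] at h3 h4
    rw [hd]
    simp only [EuclideanSpace.inner_single_right, one_mul, conj_trivial]
    rcases abs_cases (u (0, 0) - u (0, 1)) with h | h <;> linarith
  have hswap := integral_comp_of_map_eq (measurable_reindexVec _) (map_reindexVec
    (swapIndex_injective (n := n))) (integrable_supportFn permVec)
  have hi1 := integrable_inner_stdGaussian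
    (EuclideanSpace.single (0, 0) 1 : EuclideanSpace ℝ (Fin (n + 2) × Fin (n + 2)))
  have hi2 := integrable_inner_stdGaussian
    (EuclideanSpace.single (0, 1) 1 : EuclideanSpace ℝ (Fin (n + 2) × Fin (n + 2)))
  have hm0 := integral_minorVec (n := n + 1) 0
  have hm1 := integral_minorVec (n := n + 1) 1
  have h := integral_mono (((hi1.add hi2).add (hm0.1.add hm1.1)).add
    (integrable_inner_stdGaussian d).abs) ((integrable_supportFn permVec).add hswap.1) hpt
  rw [integral_add' ((hi1.add hi2).add (hm0.1.add hm1.1)) (integrable_inner_stdGaussian d).abs,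
    integral_add' (hi1.add hi2) (hm0.1.add hm1.1), integral_add' hi1 hi2,
    integral_add' hm0.1 hm1.1, integral_add' (integrable_supportFn permVec) hswap.1,
    integral_inner_stdGaussian, integral_inner_stdGaussian, hm0.2, hm1.2, integral_abs_inner,
    hnorm, hswap.2] at h
  change _ ≤ meanSupport (n + 2) + meanSupport (n + 2) at h
  have h2 : √2 * √(2 / Real.pi) = 2 * (1 / √Real.pi) := by
    rw [Real.sqrt_div (by norm_num), ← mul_div_assoc, Real.mul_self_sqrt (by norm_num)]
    ring
  rw [h2] at h
  linarith

end Recursion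

/-! ### The case `n = 3` and the lower bounds. -/

section Three

variable {n : ℕ}

/-- The matrix `M` as a vector of `ℝ^(3 × 3)`. -/
def matVec (M : Fin 3 → Fin 3 → ℝ) : EuclideanSpace ℝ (Fin 3 × Fin 3) :=
  WithLp.toLp 2 fun ij => M ij.1 ij.2

lemma inner_matVec (u : EuclideanSpace ℝ (Fin 3 × Fin 3)) (M : Fin 3 → Fin 3 → ℝ) :
    ⟪u, matVec M⟫ = ∑ i, ∑ j, u (i, j) * M i j := by
  rw [PiLp.inner_apply, Fintype.sum_prod_type]
  simp [matVec, mul_comm]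

lemma norm_matVec_sq (M : Fin 3 → Fin 3 → ℝ) : ‖matVec M‖ ^ 2 = ∑ i, ∑ j, M i j ^ 2 := by
  rw [EuclideanSpace.real_norm_sq_eq, Fintype.sum_prod_type]
  rfl

/-- Keep the row `0` and the sum of the rows `1` and `2`, and shift the difference of the rows `1`
and `2` by `s`. -/
def shiftVec (s : Fin 3) (u : EuclideanSpace ℝ (Fin 3 × Fin 3)) :
    EuclideanSpace ℝ (Fin 3 × Fin 3) :=
  matVec ![fun k => u (0, k),
    fun k => (u (1, k) + u (2, k) + (u (1, k + s) - u (2, k + s))) / 2,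
    fun k => (u (1, k) + u (2, k) - (u (1, k + s) - u (2, k + s))) / 2]

lemma measurable_shiftVec (s : Fin 3) : Measurable (shiftVec s) := by
  refine (WithLp.measurable_toLp 2 _).comp (measurable_pi_lambda _ fun ik => ?_)
  obtain ⟨i, k⟩ := ik
  fin_cases i <;> simp <;> fun_prop

lemma map_shiftVec (s : Fin 3) :
    (stdGaussian (EuclideanSpace ℝ (Fin 3 × Fin 3))).map (shiftVec s) = stdGaussian _ := by
  refine map_stdGaussian_of_adjoint (f' := shiftVec (-s)) (measurable_shiftVec s)
    (fun x t => ?_) fun t => ?_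
  · rw [shiftVec, real_inner_comm, shiftVec, inner_matVec, inner_matVec]
    fin_cases s <;> 
      simp [Fin.sum_univ_three, show (-1 : Fin 3) = 2 from rfl, show (-2 : Fin 3) = 1 from rfl] <;>
      ring
  · rw [← sq_eq_sq₀ (norm_nonneg _) (norm_nonneg _), shiftVec, norm_matVec_sq,
      EuclideanSpace.real_norm_sq_eq, Fintype.sum_prod_type]
    fin_cases s <;> 
      simp [Fin.sum_univ_three, show (-1 : Fin 3) = 2 from rfl, show (-2 : Fin 3) = 1 from rfl] <;>
      ring

/-- Row `0` minus the mean of rows `1` and `2`, as a difference between two columns. -/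
def rowContrast (j k : Fin 3) (u : EuclideanSpace ℝ (Fin 3 × Fin 3)) : ℝ :=
  (u (0, j) - (u (1, j) + u (2, j)) / 2) - (u (0, k) - (u (1, k) + u (2, k)) / 2)

/-- The difference between the two diagonals of a minor. -/
def minorContrast (j k : Fin 3) (u : EuclideanSpace ℝ (Fin 3 × Fin 3)) : ℝ :=
  (u (1, j) - u (2, j)) - (u (1, k) - u (2, k))

lemma exists_perm_three : ∀ a b c : Fin 3, a ≠ b → a ≠ c → b ≠ c →
    ∃ σ : Equiv.Perm (Fin 3), σ 0 = a ∧ σ 1 = b ∧ σ 2 = c := by decide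

lemma le_supportFn_three (u : EuclideanSpace ℝ (Fin 3 × Fin 3)) {a b c : Fin 3} (hab : a ≠ b)
    (hac : a ≠ c) (hbc : b ≠ c) : u (0, a) + u (1, b) + u (2, c) ≤ supportFn permVec u := by
  obtain ⟨σ, h0, h1, h2⟩ := exists_perm_three a b c hab hac hbc
  have := sum_le_supportFn u σ
  rwa [Fin.sum_univ_three, h0, h1, h2] at this

lemma minor_le_supportFn (u : EuclideanSpace ℝ (Fin 3 × Fin 3)) {a b c : Fin 3} (hab : a ≠ b)
    (hac : a ≠ c) (hbc : b ≠ c) :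
    u (0, a) + (u (1, b) + u (2, b) + u (1, c) + u (2, c)) / 2 + |minorContrast b c u| / 2 ≤
      supportFn permVec u := by
  have h1 := le_supportFn_three u hab hac hbc
  have h2 := le_supportFn_three u hac hab hbc.symm
  unfold minorContrast
  rcases abs_cases (u (1, b) - u (2, b) - (u (1, c) - u (2, c))) with h | h <;> linarith

lemma shiftVec_zero (s k : Fin 3) (u : EuclideanSpace ℝ (Fin 3 × Fin 3)) :
    shiftVec s u (0, k) = u (0, k) := rfl

lemma shiftVec_add (s k : Fin 3) (u : EuclideanSpace ℝ (Fin 3 × Fin 3)) :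
    shiftVec s u (1, k) + shiftVec s u (2, k) = u (1, k) + u (2, k) := by
  simp [shiftVec, matVec]; ring

lemma shiftVec_sub (s k : Fin 3) (u : EuclideanSpace ℝ (Fin 3 × Fin 3)) :
    shiftVec s u (1, k) - shiftVec s u (2, k) = u (1, k + s) - u (2, k + s) := by
  simp [shiftVec, matVec]; ring

/-- The three shifts move the pair of columns `b, c` through all pairs, so the contrast term becomes
the same for every choice of `a`. The choice of `a` can then be optimized on the other term alone.
-/
lemma minor_le_sum_supportFn (u : EuclideanSpace ℝ (Fin 3 × Fin 3)) {a b c : Fin 3} (hab : a ≠ b)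
    (hac : a ≠ c) (hbc : b ≠ c) :
    3 * (u (0, a) + (u (1, b) + u (2, b) + u (1, c) + u (2, c)) / 2) +
      (∑ s, |minorContrast (b + s) (c + s) u|) / 2 ≤
      ∑ s, supportFn permVec (shiftVec s u) := by
  have h : ∀ s, u (0, a) + (u (1, b) + u (2, b) + u (1, c) + u (2, c)) / 2 +
      |minorContrast (b + s) (c + s) u| / 2 ≤ supportFn permVec (shiftVec s u) := fun s => by
    have h1 := minor_le_supportFn (shiftVec s u) hab hac hbc
    rw [minorContrast, shiftVec_sub, shiftVec_sub, shiftVec_zero] at h1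
    have h2 := shiftVec_add s b u
    have h3 := shiftVec_add s c u
    unfold minorContrast
    linarith
  have := Finset.sum_le_sum fun s (_ : s ∈ Finset.univ) => h s
  rw [Finset.sum_add_distrib, ← Finset.sum_div] at this
  simpa [mul_add] using this

/-- Up to a term common to all `a`, choosing `a` in row `0` contributes three times its entry minus
the mean of the two entries below. Using `u` and `-u` captures the range of these three values,
which is half the sum of their pairwise distances. -/
lemma contrast_le_sum_supportFn (u : EuclideanSpace ℝ (Fin 3 × Fin 3)) :
    3 / 2 * (|rowContrast 0 1 u| + |rowContrast 1 2 u| + |rowContrast 0 2 u|) +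
      (|minorContrast 0 1 u| + |minorContrast 1 2 u| + |minorContrast 2 0 u|) ≤
    ∑ s, (supportFn permVec (shiftVec s u) + supportFn permVec (shiftVec s (-u))) := by
  have hneg : ∀ j k, |minorContrast j k (-u)| = |minorContrast j k u| := fun j k => by
    rw [← abs_neg]; simp [minorContrast]; ring_nf
  have h0 := fun w => minor_le_sum_supportFn w (a := 0) (b := 1) (c := 2) (by decide) (by decide)
    (by decide)
  have h1 := fun w => minor_le_sum_supportFn w (a := 1) (b := 2) (c := 0) (by decide) (by decide)
    (by decide)
  have h2 := fun w => minor_le_sum_supportFn w (a := 2) (b := 0) (c := 1) (by decide) (by decide)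
    (by decide)
  have p0 := h0 u
  have p1 := h1 u
  have p2 := h2 u
  have n0 := h0 (-u)
  have n1 := h1 (-u)
  have n2 := h2 (-u)
  rw [Finset.sum_add_distrib]
  generalize ∑ s, supportFn permVec (shiftVec s u) = A at *
  generalize ∑ s, supportFn permVec (shiftVec s (-u)) = B at *
  simp only [hneg, Fin.sum_univ_three, show (1 + 1 : Fin 3) = 2 from rfl,
    show (2 + 1 : Fin 3) = 0 from rfl, show (1 + 2 : Fin 3) = 0 from rfl,
    show (2 + 2 : Fin 3) = 1 from rfl, zero_add, add_zero, PiLp.neg_apply] at p0 p1 p2 n0 n1 n2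
  unfold rowContrast
  rcases abs_cases (u (0, 0) - (u (1, 0) + u (2, 0)) / 2 - (u (0, 1) - (u (1, 1) + u (2, 1)) / 2))
    with h | h <;>
  rcases abs_cases (u (0, 1) - (u (1, 1) + u (2, 1)) / 2 - (u (0, 2) - (u (1, 2) + u (2, 2)) / 2))
    with h' | h' <;>
  rcases abs_cases (u (0, 0) - (u (1, 0) + u (2, 0)) / 2 - (u (0, 2) - (u (1, 2) + u (2, 2)) / 2))
    with h'' | h'' <;>
  linarith

lemma integral_abs_rowContrast {j k : Fin 3} (hjk : j ≠ k) :
    Integrable (fun u => |rowContrast j k u|) (stdGaussian _) ∧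
      ∫ u, |rowContrast j k u| ∂(stdGaussian _) = √3 * √(2 / Real.pi) := by
  let d := matVec fun i l =>
    (if l = j then 1 else if l = k then -1 else 0) * (if i = 0 then 1 else -1 / 2)
  have h : ∀ u, rowContrast j k u = ⟪u, d⟫ := fun u => by
    simp only [d, inner_matVec, rowContrast]
    fin_cases j <;> fin_cases k <;> first | exact absurd rfl hjk | skip
    all_goals simp [Fin.sum_univ_three]; ring
  have hd : ‖d‖ = √3 := by
    rw [← Real.sqrt_sq (norm_nonneg d), norm_matVec_sq]
    congr 1
    fin_cases j <;> fin_cases k <;> first | exact absurd rfl hjk | skip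
    all_goals simp [Fin.sum_univ_three]; norm_num
  simp_rw [h]
  exact ⟨(integrable_inner_stdGaussian d).abs, by rw [integral_abs_inner, hd]⟩

lemma integral_abs_minorContrast {j k : Fin 3} (hjk : j ≠ k) :
    Integrable (fun u => |minorContrast j k u|) (stdGaussian _) ∧
      ∫ u, |minorContrast j k u| ∂(stdGaussian _) = 2 * √(2 / Real.pi) := by
  let d := matVec fun i l =>
    (if l = j then 1 else if l = k then -1 else 0) * (if i = 0 then 0 else if i = 1 then 1 else -1)
  have h : ∀ u, minorContrast j k u = ⟪u, d⟫ := fun u => by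
    simp only [d, inner_matVec, minorContrast]
    fin_cases j <;> fin_cases k <;> first | exact absurd rfl hjk | skip
    all_goals simp [Fin.sum_univ_three]; ring
  have hd : ‖d‖ = 2 := by
    rw [← Real.sqrt_sq (norm_nonneg d), norm_matVec_sq, show (2 : ℝ) = √(2 ^ 2) by simp]
    congr 1
    fin_cases j <;> fin_cases k <;> first | exact absurd rfl hjk | skip
    all_goals simp [Fin.sum_univ_three]; norm_num
  simp_rw [h]
  exact ⟨(integrable_inner_stdGaussian d).abs, by rw [integral_abs_inner, hd]⟩

theorem le_meanSupport_three : (3 * √3 / 4 + 1) * √(2 / Real.pi) ≤ meanSupport 3 := by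
  have hs : ∀ s, Integrable (fun u => supportFn permVec (shiftVec s u)) (stdGaussian _) ∧
      ∫ u, supportFn permVec (shiftVec s u) ∂(stdGaussian _) = meanSupport 3 := fun s =>
    integral_comp_of_map_eq (measurable_shiftVec s) (map_shiftVec s) (integrable_supportFn _)
  have hneg : ∀ s, Integrable (fun u => supportFn permVec (shiftVec s (-u))) (stdGaussian _) ∧
      ∫ u, supportFn permVec (shiftVec s (-u)) ∂(stdGaussian _) = meanSupport 3 := fun s => by
    rw [← (hs s).2]
    exact integral_comp_of_map_eq (by fun_prop)
      (stdGaussian_map (LinearIsometryEquiv.neg ℝ)) (hs s).1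
  have r01 := integral_abs_rowContrast (j := 0) (k := 1) (by decide)
  have r12 := integral_abs_rowContrast (j := 1) (k := 2) (by decide)
  have r02 := integral_abs_rowContrast (j := 0) (k := 2) (by decide)
  have m01 := integral_abs_minorContrast (j := 0) (k := 1) (by decide)
  have m12 := integral_abs_minorContrast (j := 1) (k := 2) (by decide)
  have m20 := integral_abs_minorContrast (j := 2) (k := 0) (by decide)
  have hr := ((r01.1.add r12.1).add r02.1).const_mul (3 / 2)
  have hm := (m01.1.add m12.1).add m20.1
  have h := integral_mono (hr.add hm)
    (integrable_finsetSum Finset.univ fun s _ => (hs s).1.add (hneg s).1)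
    contrast_le_sum_supportFn
  rw [integral_add' hr hm, integral_const_mul, integral_add' (r01.1.add r12.1) r02.1,
    integral_add' r01.1 r12.1, integral_add' (m01.1.add m12.1) m20.1, integral_add' m01.1 m12.1,
    integral_finsetSum _ fun s _ => (hs s).1.add (hneg s).1, r01.2, r12.2, r02.2, m01.2, m12.2,
    m20.2, Finset.sum_congr rfl fun s _ => (integral_add' (hs s).1 (hneg s).1).trans
      (congrArg₂ _ (hs s).2 (hneg s).2)] at h
  simp only [Finset.sum_const, Finset.card_univ, Fintype.card_fin, nsmul_eq_mul] at h
  push_cast at h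
  linarith

/-- Starting the recursion at `meanSupport 1 = 0` would give only `(n - 1) / √π`. The sharper
estimate at `n = 3` supplies the missing unit. -/
theorem le_meanSupport (hn : 3 ≤ n) : n / √Real.pi ≤ meanSupport n := by
  have hpi : 0 < √Real.pi := Real.sqrt_pos.2 Real.pi_pos
  induction n, hn using Nat.le_induction with
  | base =>
    refine le_trans ?_ le_meanSupport_three
    rw [Real.sqrt_div (by norm_num), ← mul_div_assoc]
    gcongr
    have h1 : (1.7 : ℝ) ≤ √3 := Real.le_sqrt_of_sq_le (by norm_num)
    have h2 : (1.4 : ℝ) ≤ √2 := Real.le_sqrt_of_sq_le (by norm_num)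
    push_cast
    nlinarith
  | succ n hn ih =>
    obtain ⟨m, rfl⟩ : ∃ m, n = m + 1 := ⟨n - 1, by omega⟩
    have := meanSupport_add_le (n := m)
    push_cast at ih ⊢
    rw [add_div _ 1 √Real.pi]
    linarith

theorem four_le_expectedShadowSize_of_four_le (hn : 4 ≤ n) :
    4 ≤ expectedShadowSize (birkhoffPolytope n) := by
  have h1 := meanSupport_le_expectedShadowSize (n := n) (by omega)
  have h2 := le_meanSupport (n := n) (by omega)
  have hpi : 0 < √Real.pi := Real.sqrt_pos.2 Real.pi_pos
  have hn4 : (4 : ℝ) ≤ n := by exact_mod_cast hn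
  have hsn : (2 : ℝ) ≤ √n := Real.le_sqrt_of_sq_le (by linarith)
  have h3 : √(n : ℝ) * √n = n := Real.mul_self_sqrt (by linarith)
  rw [Real.sqrt_mul (by norm_num), Real.sqrt_mul (by norm_num)] at h1
  rw [div_le_iff₀ hpi] at h2
  have h4 : √2 * (2 * (√n * √n)) ≤
      √2 * (√n * expectedShadowSize (birkhoffPolytope n)) := by
    have : 2 * (√n * √n) ≤ 2 * (meanSupport n * √Real.pi) := by rw [h3]; linarith
    have := mul_le_mul_of_nonneg_left this (Real.sqrt_nonneg 2)
    nlinarith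
  have h5 := le_of_mul_le_mul_left h4 (by positivity)
  have h6 : 2 * √n ≤ expectedShadowSize (birkhoffPolytope n) := by
    have : √n * (2 * √n) ≤ √n * expectedShadowSize (birkhoffPolytope n) := by linarith
    exact le_of_mul_le_mul_left this (by linarith)
  linarith

/-- Data on a pair of permutations of `Fin 3` of the same sign. -/
lemma agree_three : ∀ σ τ : Equiv.Perm (Fin 3), (∀ i, σ i ≠ τ i) →
    ∃ β : Fin 3 → Equiv.Perm (Fin 3),
    (∀ j, β j ≠ σ ∧ β j ≠ τ ∧ (Finset.univ.filter fun i => β j i = σ i).card = 1 ∧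
      (Finset.univ.filter fun i => β j i = τ i).card = 1) ∧
    ∀ j k, j ≠ k → (Finset.univ.filter fun i => β j i = β k i).card = 0 := by
  intro σ τ h
  -- These are the three permutations of the opposite sign. On three letters, permutations of
  -- opposite sign agree exactly once, and distinct ones of equal sign never.
  refine ⟨![σ * Equiv.swap 0 1, σ * Equiv.swap 1 2, σ * Equiv.swap 0 2], ?_⟩
  revert σ τ
  decide

/-- At `n = 3`, an edge between permutations of the same sign is rarely seen. -/
lemma edgeProb_three_le (σ τ : Equiv.Perm (Fin 3)) (h : ∀ i, σ i ≠ τ i) :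
    edgeProb permVec σ τ ≤ 1 / 5 := by
  obtain ⟨β, hβ, hββ⟩ := agree_three σ τ h
  have hne : σ ≠ τ := fun h' => h 0 (by rw [h'])
  let m : EuclideanSpace ℝ (Fin 3 × Fin 3) := (1 / 2 : ℝ) • (permVec σ + permVec τ)
  let w : Fin 3 → EuclideanSpace ℝ (Fin 3 × Fin 3) := fun j => permVec (β j) - m
  have i1 : ∀ j, ⟪permVec (β j), permVec σ⟫ = 1 := fun j => by
    rw [inner_permVec_permVec, (hβ j).2.2.1]; norm_num
  have i2 : ∀ j, ⟪permVec (β j), permVec τ⟫ = 1 := fun j => by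
    rw [inner_permVec_permVec, (hβ j).2.2.2]; norm_num
  have i3 : ⟪permVec σ, permVec τ⟫ = 0 := by
    rw [inner_permVec_permVec]; simp [h]
  have i1' : ∀ j, ⟪permVec σ, permVec (β j)⟫ = 1 := fun j => by rw [real_inner_comm, i1]
  have i2' : ∀ j, ⟪permVec τ, permVec (β j)⟫ = 1 := fun j => by rw [real_inner_comm, i2]
  have i3' : ⟪permVec τ, permVec σ⟫ = 0 := by rw [real_inner_comm, i3]
  have i4 : ∀ ρ : Equiv.Perm (Fin 3), ⟪permVec ρ, permVec ρ⟫ = 3 := fun ρ => by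
    rw [inner_permVec_permVec]; simp
  have i5 : ∀ j k, j ≠ k → ⟪permVec (β j), permVec (β k)⟫ = 0 := fun j k hjk => by
    rw [inner_permVec_permVec, hββ j k hjk]; norm_num
  have hinner : ∀ j k, ⟪w j, w k⟫ = ⟪permVec (β j), permVec (β k)⟫ - 1 / 2 := fun j k => by
    simp only [w, m, inner_sub_left, inner_sub_right, inner_add_left, inner_add_right,
      real_inner_smul_left, real_inner_smul_right, i1, i2, i3, i4, i1', i2', i3']
    ring
  have hw : ∀ j, w j ≠ 0 := fun j h0 => by
    have := hinner j j
    rw [h0, inner_zero_left, i4] at this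
    norm_num at this
  have hneg : ∀ j k, j ≠ k → ⟪w j, w k⟫ ≤ 0 := fun j k hjk => by
    rw [hinner, i5 j k hjk]; norm_num
  refine le_trans ?_ (measureReal_signCone_le hw hneg)
  rw [edgeProb, measureReal_def, prod_edgeSet permVec_injective hne]
  refine ENNReal.toReal_mono (measure_ne_top _ _) (measure_mono fun x hx j => ?_)
  have h1 := hx (β j) (hβ j).1 (hβ j).2.1
  -- `permVec (β j)` is equidistant from the ends of the edge, so its projection orthogonal to the
  -- edge is measured from the midpoint `m`. Distinct `w j` have inner product `-1 / 2`, as the cone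
  -- bound requires.
  have h2 : orthComp (permVec σ - permVec τ) (permVec (β j) - permVec σ) = w j := by
    have hn : ‖permVec σ - permVec τ‖ ^ 2 = 6 := by
      rw [← real_inner_self_eq_norm_sq]
      simp only [inner_sub_left, inner_sub_right, i3, i4, i3']
      norm_num
    have hi : ⟪permVec (β j) - permVec σ, permVec σ - permVec τ⟫ = -3 := by
      simp only [inner_sub_left, inner_sub_right, i1, i2, i3, i4]
      norm_num
    rw [orthComp, alongComp, hn, hi]
    simp only [w, m]
    module
  rw [orthComp_inner, h2] at h1
  simpa using h1

lemma card_disagree_three : ∀ σ τ : Equiv.Perm (Fin 3), σ ≠ τ → ¬(∀ i, σ i ≠ τ i) →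
    (Finset.univ.filter fun i => σ i ≠ τ i).card = 2 := by decide

lemma card_derangements_three :
    (Finset.univ.filter fun e : Equiv.Perm (Fin 3) × Equiv.Perm (Fin 3) =>
    ∀ i, e.1 i ≠ e.2 i).card = 12 := by decide

/-- Dividing the length identity by the largest length `√6` gives only about `3.75`. Charging every
edge the length `2`, plus an excess `√6 - 2` for 12 pairs of probability at most `1 / 5`, gives `3√3
+ 4 ≤ 2 E + 12 (√6 - 2) / 5` for the expected size `E`, hence `E > 4`. -/
theorem four_le_expectedShadowSize_three : 4 ≤ expectedShadowSize (birkhoffPolytope 3) := by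
  have h6 : (2 : ℝ) ≤ √6 := Real.le_sqrt_of_sq_le (by norm_num)
  have hpt : ∀ e : Equiv.Perm (Fin 3) × Equiv.Perm (Fin 3),
      ‖permVec e.1 - permVec e.2‖ * edgeProb permVec e.1 e.2 ≤
      2 * edgeProb permVec e.1 e.2 + if ∀ i, e.1 i ≠ e.2 i then (√6 - 2) / 5 else 0 := by
    rintro ⟨σ, τ⟩
    have hsq := norm_permVec_sub_sq σ τ
    split_ifs with h
    · have hn : ‖permVec σ - permVec τ‖ = √6 := by
        rw [← Real.sqrt_sq (norm_nonneg _), hsq, Finset.filter_true_of_mem fun i _ => h i]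
        norm_num
      have hp := edgeProb_three_le σ τ h
      simp only
      rw [hn]
      nlinarith
    · by_cases hne : σ = τ
      · simp [hne, edgeProb_self]
      · have hn : ‖permVec σ - permVec τ‖ = 2 := by
          rw [← Real.sqrt_sq (norm_nonneg _), hsq, card_disagree_three σ τ hne h]
          rw [show (2 : ℝ) * (2 : ℕ) = 2 ^ 2 by norm_num, Real.sqrt_sq (by norm_num)]
        simp [hn]
  have h1 := Finset.sum_le_sum fun e (_ : e ∈ Finset.univ) => hpt e
  rw [sum_norm_mul_edgeProb_permVec (by norm_num), Finset.sum_add_distrib, ← Finset.mul_sum,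
    ← expectedShadowSize_birkhoffPolytope (by norm_num), ← Finset.sum_filter, Finset.sum_const,
    card_derangements_three] at h1
  have h2 := mul_le_mul_of_nonneg_left le_meanSupport_three (Real.sqrt_nonneg (2 * Real.pi))
  have h3 : √(2 * Real.pi) * √(2 / Real.pi) = 2 := by
    rw [← Real.sqrt_mul (by positivity), show 2 * Real.pi * (2 / Real.pi) = 2 ^ 2 by
      field_simp]
    simp
  have h4 : √(2 * Real.pi) * ((3 * √3 / 4 + 1) * √(2 / Real.pi)) = 2 * (3 * √3 / 4 + 1) := by
    linear_combination (3 * √3 / 4 + 1) * h3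
  have h5 : (1.73 : ℝ) ≤ √3 := Real.le_sqrt_of_sq_le (by norm_num)
  have h7 : √6 ≤ 2.45 := Real.sqrt_le_iff.2 ⟨by norm_num, by norm_num⟩
  simp only [nsmul_eq_mul] at h1
  push_cast at h1
  nlinarith

end Three

end RandomShadow

end

theorem mainTheorem8 :
    (∀ n : ℕ, 2 ≤ n →
      MeasureTheory.Integrable
        (fun p : EuclideanSpace ℝ (Fin n × Fin n) × EuclideanSpace ℝ (Fin n × Fin n) =>
          (RandomShadow.shadowSize (RandomShadow.birkhoffPolytope n) p.1 p.2 : ℝ))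
        (RandomShadow.uniformOrthonormalPair (EuclideanSpace ℝ (Fin n × Fin n)))) ∧
    (∀ n : ℕ, 3 ≤ n →
      4 ≤ RandomShadow.expectedShadowSize (RandomShadow.birkhoffPolytope n)) ∧
    (∃ C : ℝ, 0 < C ∧ ∀ n : ℕ, 2 ≤ n →
      RandomShadow.expectedShadowSize (RandomShadow.birkhoffPolytope n) ≤
        C * (n : ℝ) ^ (3 / 2 : ℝ)) := by
  refine ⟨fun n hn => ?_, fun n hn => ?_, √(2 * Real.pi), Real.sqrt_pos.2 (by positivity),
    fun n hn => RandomShadow.expectedShadowSize_birkhoffPolytope_le hn⟩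
  · have := RandomShadow.nontrivial_perm hn
    exact RandomShadow.integrable_shadowSize RandomShadow.permVec_injective
      RandomShadow.norm_permVec_eq
  · rcases hn.eq_or_lt with rfl | hn
    · exact RandomShadow.four_le_expectedShadowSize_three
    · exact RandomShadow.four_le_expectedShadowSize_of_four_le hn
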